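/- Let $\mathcal{A}$ be a line arrangement in $\mathbb{P}^2_{\mathbb{C}}$, i.e. a finite set of $d \geq 2$ distinct lines, with defining polynomial $f_{\mathcal{A}} \in \mathbb{C}[y_0,y_1,y_2]_d$ (the product of linear forms defining the lines). For a point $P$ let $m(P,\mathcal{A})$ be the number of lines of $\mathcal{A}$ through $P$, let $\mathrm{Sing}(\mathcal{A})$ be the set of points $P$ with $m(P,\mathcal{A}) \geq 2$, and let $m := m(\mathcal{A}) = \max\{m(P,\mathcal{A}) : P \in \mathrm{Sing}(\mathcal{A})\}$. Assume that $\mathcal{A}$ is supersolvable, i.e. there is a point $P$ such that for every $Q \in \mathrm{Sing}(\mathcal{A})$ with $Q \neq P$ the line joining $P$ and $Q$ belongs to $\mathcal{A}$. Then $\mathcal{A}$ is free with splitting type $(m-1, d-m)$; that is, the derivation bundle $$\mathcal{D}_{\mathcal{A}} := \ker\Big(\mathcal{O}_{\mathbb{P}^2}^3 \xrightarrow{\ (\partial_{y_0} f_{\mathcal{A}},\ \partial_{y_1} f_{\mathcal{A}},\ \partial_{y_2} f_{\mathcal{A}})\ } \mathcal{O}_{\mathbb{P}^2}(d-1)\Big)$$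 is isomorphic, as a sheaf of $\mathcal{O}_{\mathbb{P}^2}$-modules, to $\mathcal{O}_{\mathbb{P}^2}(-(m-1)) \oplus \mathcal{O}_{\mathbb{P}^2}(-(d-m))$. -/

import Mathlib

open scoped LinearAlgebra.Projectivization

noncomputable section

namespace LineArr

open AlgebraicGeometry TopologicalSpace Opposite MvPolynomial CategoryTheory

/-! ### Twisting sheaves on the projective plane -/

/-- The homogeneous coordinate ring `T = ℂ[y₀, y₁, y₂]`. -/
abbrev T : Type := MvPolynomial (Fin 3) ℂ

/-- The grading of `T` by degree. -/
abbrev grading : ℕ → Submodule ℂ T := fun n => homogeneousSubmodule (Fin 3) ℂ n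

instance : GradedAlgebra grading := MvPolynomial.gradedAlgebra

/-- The projective plane `ℙ² = Proj T`, as a topological space. -/
abbrev P2 : TopCat := ProjectiveSpectrum.top grading

/-- The ring `𝒪(U)` of sections of the structure sheaf of `Proj T`. -/
abbrev OSec (U : Opens P2) : Type :=
  (ProjectiveSpectrum.Proj.structureSheaf grading).1.obj (op U)

/-- The restriction map `𝒪(U) → 𝒪(V)` of the structure sheaf, for `V ⊆ U`. -/
def OSec.res {U V : Opens P2} (h : V ≤ U) : OSec U →+* OSec V :=
  ((ProjectiveSpectrum.Proj.structureSheaf grading).1.map (homOfLE h).op).hom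

/-- The (ungraded) localization `T_x` of `T` at the homogeneous prime ideal `x`. -/
abbrev Loc (x : ProjectiveSpectrum grading) : Type :=
  Localization.AtPrime x.asHomogeneousIdeal.toIdeal

/-- Families, indexed by the points `x` of `U`, of elements of the localizations `T_x`. -/
abbrev Germs (U : Opens P2) : Type := ∀ x : U, Loc x.1

/-- A section of the structure sheaf, viewed as a family of elements of `T_x`; its value at `x`
lies in the homogeneous localization, i.e. in the degree zero part of `T_x`. -/
def OSec.toGerms (U : Opens P2) : OSec U →+* Germs U where
  toFun s := fun x => (s.1 x).val
  map_zero' := by ext x; exact HomogeneousLocalization.val_zero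
  map_one' := by ext x; exact HomogeneousLocalization.val_one
  map_add' s t := by ext x; exact HomogeneousLocalization.val_add _ _
  map_mul' s t := by ext x; exact HomogeneousLocalization.val_mul _ _

/-- `𝒪(U)` acts on families of germs by pointwise multiplication. -/
instance (U : Opens P2) : Module (OSec U) (Germs U) := Module.compHom _ (OSec.toGerms U)

theorem smul_germs_apply {U : Opens P2} (s : OSec U) (t : Germs U) (x : U) :
    (s • t) x = (s.1 x).val * t x := rfl

/-- A family of germs on `U` is locally a fraction of degree `n` if every point of `U` has an open
neighbourhood `V ⊆ U` on which it is given by a single fraction `p / q`, where `p`, `q` are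
homogeneous with `deg p = deg q + n` and `q` vanishes nowhere on `V`. -/
def IsLocallyFractionOfDegree (n : ℤ) {U : Opens P2} (t : Germs U) : Prop :=
  ∀ x ∈ U, ∃ (V : Opens P2) (hVU : V ≤ U), x ∈ V ∧
    ∃ (j i : ℕ) (p q : T), (j : ℤ) = i + n ∧ p.IsHomogeneous j ∧ q.IsHomogeneous i ∧
      ∀ (y : P2) (hy : y ∈ V), q ∉ y.asHomogeneousIdeal ∧
        t ⟨y, hVU hy⟩ * algebraMap T (Loc _) q = algebraMap T (Loc _) p

theorem IsLocallyFractionOfDegree.zero (n : ℤ) (U : Opens P2) :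
    IsLocallyFractionOfDegree n (0 : Germs U) := by
  intro x hx
  obtain ⟨i, j, hij⟩ : ∃ i j : ℕ, (j : ℤ) = i + n := ⟨(-n).toNat, n.toNat, by omega⟩
  -- a homogeneous `q` of the prescribed degree that does not vanish at `x`
  obtain ⟨k, hk⟩ : ∃ k : Fin 3, (X k : T) ∉ x.asHomogeneousIdeal := by
    by_contra! hcon
    apply x.not_irrelevant_le
    intro f hf
    rw [HomogeneousIdeal.mem_irrelevant_iff] at hf
    have h0 : f ∈ Ideal.span (Set.range (X : Fin 3 → T)) := by
      rw [← Set.image_univ, mem_ideal_span_X_image]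
      intro m hm
      have hm0 : m ≠ 0 := by
        rintro rfl
        have h1 : homogeneousComponent 0 f = 0 := by
          have h2 := hf
          rw [GradedRing.proj_apply] at h2
          have h3 : ((DirectSum.decompose grading f) 0 : T) = homogeneousComponent 0 f :=
            MvPolynomial.decomposition.decompose'_apply f 0
          rw [← h3]; exact h2
        rw [homogeneousComponent_zero] at h1
        rw [mem_support_iff] at hm
        exact hm (by simpa using h1)
      obtain ⟨k, hk⟩ := Finsupp.ne_iff.mp hm0
      exact ⟨k, trivial, hk⟩
    have hle : Ideal.span (Set.range (X : Fin 3 → T)) ≤ x.asHomogeneousIdeal.toIdeal := by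
      rw [Ideal.span_le]
      rintro _ ⟨k, rfl⟩
      exact hcon k
    exact hle h0
  refine ⟨U ⊓ ProjectiveSpectrum.basicOpen grading (X k), inf_le_left, ⟨hx, hk⟩, j, i, 0,
    X k ^ i, hij, isHomogeneous_zero _ _ _, isHomogeneous_X_pow k i, ?_⟩
  intro y hy
  refine ⟨fun h => hy.2 (y.isPrime.mem_of_pow_mem i h), by simp⟩

theorem IsLocallyFractionOfDegree.add {n : ℤ} {U : Opens P2} {s t : Germs U}
    (hs : IsLocallyFractionOfDegree n s) (ht : IsLocallyFractionOfDegree n t) :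
    IsLocallyFractionOfDegree n (s + t) := by
  intro x hx
  obtain ⟨V, hV, hxV, j, i, p, q, e, hp, hq, H⟩ := hs x hx
  obtain ⟨V', hV', hxV', j', i', p', q', e', hp', hq', H'⟩ := ht x hx
  refine ⟨V ⊓ V', inf_le_left.trans hV, ⟨hxV, hxV'⟩, j + i', i + i', p * q' + p' * q, q * q',
    by push_cast; omega, (hp.mul hq').add ?_, hq.mul hq', ?_⟩
  · have : j + i' = j' + i := by omega
    rw [this]; exact hp'.mul hq
  · intro y hy
    obtain ⟨h1, h2⟩ := H y hy.1
    obtain ⟨h1', h2'⟩ := H' y hy.2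
    refine ⟨fun h => (y.isPrime.mem_or_mem h).elim h1 h1', ?_⟩
    rw [map_add, map_mul, map_mul, map_mul, ← h2, ← h2']
    change (s _ + t _) * _ = _
    ring

theorem IsLocallyFractionOfDegree.smul {n : ℤ} {U : Opens P2} (s : OSec U) {t : Germs U}
    (ht : IsLocallyFractionOfDegree n t) : IsLocallyFractionOfDegree n (s • t) := by
  intro x hx
  obtain ⟨V, hxV, ι, k, r, r', hr', hs⟩ := s.2 ⟨x, hx⟩
  obtain ⟨V', hV', hxV', j', i', p', q', e', hp', hq', H'⟩ := ht x hx
  refine ⟨V ⊓ V', inf_le_right.trans hV', ⟨hxV, hxV'⟩, k + j', k + i', r.1 * p', r'.1 * q',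
    by push_cast; omega, IsHomogeneous.mul r.2 hp', IsHomogeneous.mul r'.2 hq', ?_⟩
  intro y hy
  obtain ⟨h1', h2'⟩ := H' y hy.2
  refine ⟨fun h => (y.isPrime.mem_or_mem h).elim (hr' ⟨y, hy.1⟩) h1', ?_⟩
  have hsy : (s.1 ⟨y, hV' hy.2⟩).val * algebraMap T (Loc _) r'.1 = algebraMap T (Loc _) r.1 := by
    have := hs ⟨y, hy.1⟩
    have h3 : s.1 ⟨y, hV' hy.2⟩ = HomogeneousLocalization.mk ⟨k, r, r', hr' ⟨y, hy.1⟩⟩ := this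
    rw [h3, HomogeneousLocalization.val_mk, Localization.mk_eq_mk']
    exact IsLocalization.mk'_spec _ _ _
  rw [smul_germs_apply, map_mul, map_mul, ← h2', ← hsy]
  ring

/-- The `𝒪(U)`-module of sections over `U` of Serre's twisting sheaf `𝒪_{ℙ²}(n)`. -/
def twist (n : ℤ) (U : Opens P2) : Submodule (OSec U) (Germs U) where
  carrier := {t | IsLocallyFractionOfDegree n t}
  zero_mem' := .zero n U
  add_mem' := .add
  smul_mem' s _ ht := .smul s ht

/-- The restriction map `𝒪(n)(U) → 𝒪(n)(V)`, for `V ⊆ U`. -/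
def twist.res {n : ℤ} {U V : Opens P2} (h : V ≤ U) (t : twist n U) : twist n V :=
  ⟨fun x => t.1 ⟨x.1, h x.2⟩, fun x hx => by
    obtain ⟨W, hW, hxW, j, i, p, q, e, hp, hq, H⟩ := t.2 x (h hx)
    exact ⟨V ⊓ W, inf_le_left, ⟨hx, hxW⟩, j, i, p, q, e, hp, hq, fun y hy => H y hy.2⟩⟩

/-- A homogeneous polynomial `g` of degree `n` as a section of `𝒪(n)`. -/
def polySection (U : Opens P2) (g : T) (n : ℕ) (hg : g.IsHomogeneous n) : twist n U :=
  ⟨fun _ => algebraMap T (Loc _) g, fun x hx => ⟨U, le_rfl, hx, n, 0, g, 1, by simp, hg,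
    isHomogeneous_one _ _, fun y _ =>
      ⟨fun h => y.isPrime.ne_top ((Ideal.eq_top_iff_one _).mpr h), by simp⟩⟩⟩

/-! ### Line arrangements and their derivation bundles -/

/-- A line arrangement in `ℙ²(ℂ)`: a finite set of (distinct) lines. The line with coefficient
vector `(p₀ : p₁ : p₂)` is `{(y₀ : y₁ : y₂) | p₀ y₀ + p₁ y₁ + p₂ y₂ = 0}`; so the point `P` lies
on the line `L` iff `Projectivization.orthogonal L P`. -/
abbrev LineArrangement : Type := Finset (ℙ ℂ (Fin 3 → ℂ))

namespace LineArrangement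

variable (A : LineArrangement)

/-- The defining polynomial `f_A` of `A`: the product of linear forms defining its lines. -/
def poly : T := ∏ L ∈ A, ∑ i : Fin 3, C (L.rep i) * X i

theorem poly_isHomogeneous : A.poly.IsHomogeneous A.card := by
  have := IsHomogeneous.prod A (fun L => ∑ i : Fin 3, (C (L.rep i) * X i : T)) (fun _ => 1)
    (fun L _ => IsHomogeneous.sum _ _ _ fun i _ => by
      simpa using (isHomogeneous_C (Fin 3) (L.rep i)).mul (isHomogeneous_X ℂ i))
  simpa [poly] using this

/-- The map of sections over `U` of the gradient map
`(∂₀ f_A, ∂₁ f_A, ∂₂ f_A) : 𝒪³ → 𝒪(d - 1)`, with `d` the number of lines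
(for the empty arrangement all three partial derivatives vanish, so the truncated subtraction does
not affect the kernel). -/
def gradient (U : Opens P2) : (Fin 3 → OSec U) →ₗ[OSec U] twist (A.card - 1 : ℕ) U :=
  ∑ i : Fin 3, (LinearMap.proj i).smulRight
    (polySection U (pderiv i A.poly) (A.card - 1) A.poly_isHomogeneous.pderiv)

/-- The sections over `U` of the derivation bundle `𝒟_A`, the kernel of the gradient map. -/
def derivationBundle (U : Opens P2) : Submodule (OSec U) (Fin 3 → OSec U) :=
  LinearMap.ker (A.gradient U)

/-- An isomorphism of sheaves of `𝒪_{ℙ²}`-modules `𝒪(-a) ⊕ 𝒪(-b) ≅ 𝒟_A`: a family of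
`𝒪(U)`-linear isomorphisms on sections over all open sets `U`, compatible with restriction. -/
structure Splitting (a b : ℤ) where
  equiv : ∀ U : Opens P2, (twist (-a) U × twist (-b) U) ≃ₗ[OSec U] A.derivationBundle U
  equiv_res : ∀ {U V : Opens P2} (h : V ≤ U) (s : twist (-a) U) (t : twist (-b) U) (i : Fin 3),
    (equiv V (twist.res h s, twist.res h t)).1 i = OSec.res h ((equiv U (s, t)).1 i)

/-- `A` is free with splitting type (exponents) `(a, b)`: `𝒟_A ≅ 𝒪(-a) ⊕ 𝒪(-b)`. -/
def IsFreeWithSplittingType (a b : ℤ) : Prop := Nonempty (A.Splitting a b)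

/-! ### Supersolvable arrangements -/

/-- The multiplicity `m(P, A)`: the number of lines of `A` through the point `P`. -/
def mult (P : ℙ ℂ (Fin 3 → ℂ)) : ℕ := {L | L ∈ A ∧ Projectivization.orthogonal L P}.ncard

/-- `Sing(A)`: the points lying on at least two lines of `A`. -/
def Sing : Set (ℙ ℂ (Fin 3 → ℂ)) := {P | 2 ≤ A.mult P}

/-- `P` is modular: for each `Q ∈ Sing(A)` other than `P`, the line joining `P` and `Q`
is in `A`. -/
def IsModular (P : ℙ ℂ (Fin 3 → ℂ)) : Prop :=
  ∀ Q ∈ A.Sing, Q ≠ P →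
    ∃ L ∈ A, Projectivization.orthogonal L P ∧ Projectivization.orthogonal L Q

/-- `A` is supersolvable if it has a modular point. -/
def IsSupersolvable : Prop := ∃ P, A.IsModular P

/-- `m(A)`: the maximal multiplicity of a point of `Sing(A)`. -/
def maxMult : ℕ := sSup (A.mult '' A.Sing)

end LineArrangement

end LineArr

end

/-! The proof produces an explicit basis of the syzygies of the gradient, in the style of Saito's
criterion. Let `P` be a modular point of multiplicity `m`, represented by `v`, and write `f = f₁
f₂`, with `f₁` the product of the lines through `P` and `f₂` that of the remaining `k = d - m`. The
field `f₂ ∂_v` is logarithmic of degree `k`, because `∂_v` kills `f₁`. A second logarithmic field is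
sought as `η = ∇f₁ × u + g ∂_v`, of degree `m - 1`, where `u · v = 1`. It kills `f₁` for every `g`.
Tangency to the lines missing `P` prescribes `g` modulo each of their equations.

This interpolation problem is solved by `exists_interpolation`. Modularity enters because, once the
equations are normalised to take the value one at `v`, the difference of two of them is a multiple
of a line of the arrangement through `P`. This supplies the compatibility needed to add the lines
one at a time.

The determinant of the Euler field, `η` and `f₂ ∂_v` is `-m f`. Subtracting multiples of the Euler
field turns the two fields into syzygies of `∇f` whose cross product is a nonzero constant times
`∇f` (`isSyzygyBasis_of_logarithmic`). Distinctness of the lines makes `∇f` primitive, so Cramer's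
rule shows that these syzygies generate all others. The same argument applied to numerators of local
fractions, with uniqueness of coefficients, gives the isomorphism over every open set.

Finally, a modular point need not have maximal multiplicity, but any singular point of larger
multiplicity is again modular, so `P` may be chosen with `m = m(A)`. -/

noncomputable section

namespace LineArr

open AlgebraicGeometry TopologicalSpace Opposite MvPolynomial CategoryTheory

/-! ### Linear forms -/

/-- The linear form with a given coefficient vector. -/
def lin : (Fin 3 → ℂ) →ₗ[ℂ] T := Fintype.linearCombination ℂ X

theorem lin_apply (c : Fin 3 → ℂ) : lin c = ∑ i, C (c i) * X i := by
  simp [lin, Fintype.linearCombination_apply, smul_eq_C_mul]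

theorem pderiv_lin (i : Fin 3) (c : Fin 3 → ℂ) : pderiv i (lin c) = C (c i) := by
  rw [lin_apply, map_sum, Finset.sum_eq_single i]
  · simp
  · intro j _ hj
    simp [pderiv_X_of_ne hj]
  · simp

theorem lin_injective : Function.Injective lin := by
  intro c c' h
  funext i
  have := congrArg (pderiv i) h
  rw [pderiv_lin, pderiv_lin] at this
  exact C_injective _ _ this

theorem lin_isHomogeneous (c : Fin 3 → ℂ) : (lin c).IsHomogeneous 1 := by
  rw [lin_apply]
  exact IsHomogeneous.sum _ _ _ fun i _ => isHomogeneous_C_mul_X _ _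

theorem lin_ne_zero {c : Fin 3 → ℂ} (hc : c ≠ 0) : lin c ≠ 0 := by
  rw [← map_zero lin]
  exact lin_injective.ne hc

theorem irreducible_lin {c : Fin 3 → ℂ} (hc : c ≠ 0) : Irreducible (lin c) := by
  refine irreducible_of_totalDegree_eq_one
    ((lin_isHomogeneous c).totalDegree (lin_ne_zero hc)) fun x hx => ?_
  rw [isUnit_iff_ne_zero]
  rintro rfl
  refine lin_ne_zero hc (MvPolynomial.ext _ _ fun m => ?_)
  simpa using hx m

theorem prime_lin {c : Fin 3 → ℂ} (hc : c ≠ 0) : Prime (lin c) :=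
  (irreducible_lin hc).prime

theorem exists_smul_of_lin_dvd_lin {c c' : Fin 3 → ℂ} (hc' : c' ≠ 0)
    (h : lin c ∣ lin c') : ∃ a : ℂ, a ≠ 0 ∧ c' = a • c := by
  have hc : c ≠ 0 := by
    rintro rfl
    rw [map_zero, zero_dvd_iff] at h
    exact lin_ne_zero hc' h
  obtain ⟨u, hu⟩ := (irreducible_lin hc).associated_of_dvd (irreducible_lin hc') h
  obtain ⟨a, ha, hua⟩ := isUnit_iff_eq_C_of_isReduced.mp u.isUnit
  refine ⟨a, ha.ne_zero, lin_injective ?_⟩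
  rw [map_smul, ← hu, hua, smul_eq_C_mul, mul_comm]

theorem isRelPrime_lin {c c' : Fin 3 → ℂ} (hc : c ≠ 0) (h : ¬ lin c ∣ lin c') :
    IsRelPrime (lin c) (lin c') :=
  (irreducible_lin hc).isRelPrime_iff_not_dvd.mpr h

/-! ### Homogeneous components of products -/

theorem coe_decompose_eq (p : T) (n : ℕ) :
    ((DirectSum.decompose grading p) n : T) = homogeneousComponent n p :=
  MvPolynomial.decomposition.decompose'_apply p n

theorem homogeneousComponent_mul_of_le {p q : T} {i n : ℕ} (hp : p.IsHomogeneous i)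
    (h : i ≤ n) : homogeneousComponent n (p * q) = p * homogeneousComponent (n - i) q := by
  rw [← coe_decompose_eq, ← coe_decompose_eq]
  exact DirectSum.coe_decompose_mul_of_left_mem_of_le grading hp h

theorem homogeneousComponent_mul_of_not_le {p q : T} {i n : ℕ} (hp : p.IsHomogeneous i)
    (h : ¬ i ≤ n) : homogeneousComponent n (p * q) = 0 := by
  rw [← coe_decompose_eq]
  exact DirectSum.coe_decompose_mul_of_left_mem_of_not_le grading hp h

theorem exists_isHomogeneous_mul_eq {p q : T} {i n : ℕ} (hq : q.IsHomogeneous i)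
    (hp : p.IsHomogeneous n) (h : q ∣ p) : ∃ r : T, r.IsHomogeneous (n - i) ∧ p = q * r := by
  obtain ⟨r, hr⟩ := h
  have h1 : homogeneousComponent n p = p := homogeneousComponent_eq_self hp
  by_cases hi : i ≤ n
  · refine ⟨homogeneousComponent (n - i) r, homogeneousComponent_isHomogeneous _ _, ?_⟩
    rw [← homogeneousComponent_mul_of_le hq hi, ← hr, h1]
  -- The divisor has larger degree than `p`, which forces `p = 0`; the truncated degree `n - i` is
  -- then harmless.
  · refine ⟨0, isHomogeneous_zero _ _ _, ?_⟩
    rw [mul_zero, ← h1, hr, homogeneousComponent_mul_of_not_le hq hi]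

theorem dvd_homogeneousComponent {p q : T} {i : ℕ} (hq : q.IsHomogeneous i) (n : ℕ)
    (h : q ∣ p) : q ∣ homogeneousComponent n p := by
  obtain ⟨r, rfl⟩ := h
  by_cases hi : i ≤ n
  · rw [homogeneousComponent_mul_of_le hq hi]
    exact dvd_mul_right _ _
  · rw [homogeneousComponent_mul_of_not_le hq hi]
    exact dvd_zero _

/-! ### Polynomial vector fields -/

/-- The derivation `∑ wᵢ ∂ᵢ`. -/
def deriv (w : Fin 3 → T) : Derivation ℂ T T := ∑ i, w i • pderiv i

theorem deriv_apply (w : Fin 3 → T) (p : T) : deriv w p = ∑ i, w i * pderiv i p := by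
  simp [deriv, Fin.sum_univ_three]

theorem deriv_lin (w : Fin 3 → T) (c : Fin 3 → ℂ) : deriv w (lin c) = ∑ i, w i * C (c i) := by
  simp [deriv_apply, pderiv_lin]

theorem prod_dvd_deriv_prod {ι : Type*} (w : Fin 3 → T) (S : Finset ι) (l : ι → T)
    (h : ∀ i ∈ S, l i ∣ deriv w (l i)) : ∏ i ∈ S, l i ∣ deriv w (∏ i ∈ S, l i) := by
  classical
  induction S using Finset.induction_on with
  | empty => simp
  | insert a S ha ih =>
    rw [Finset.prod_insert ha, Derivation.leibniz, smul_eq_mul, smul_eq_mul]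
    have h1 := mul_dvd_mul_left (l a) (ih fun i hi => h i (Finset.mem_insert_of_mem hi))
    have h2 := mul_dvd_mul_right (h a (Finset.mem_insert_self _ _)) (∏ i ∈ S, l i)
    rw [mul_comm (deriv w (l a))] at h2
    exact dvd_add h1 h2

theorem deriv_prod_eq_zero {ι : Type*} (w : Fin 3 → T) (S : Finset ι) (l : ι → T)
    (h : ∀ i ∈ S, deriv w (l i) = 0) : deriv w (∏ i ∈ S, l i) = 0 := by
  classical
  induction S using Finset.induction_on with
  | empty => simp
  | insert a S ha ih =>
    rw [Finset.prod_insert ha, Derivation.leibniz, h a (Finset.mem_insert_self _ _),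
      ih fun i hi => h i (Finset.mem_insert_of_mem hi), smul_zero, smul_zero, add_zero]

/-! ### Projection onto a plane along a vector -/

/-- The substitution `y ↦ y - l(y) v`. -/
def proj (v n : Fin 3 → ℂ) : T →ₐ[ℂ] T := aeval fun k => X k - C (v k) * lin n

theorem proj_lin (v n c : Fin 3 → ℂ) : proj v n (lin c) = lin c - C (c ⬝ᵥ v) * lin n := by
  rw [lin_apply c, map_sum, dotProduct, map_sum, Finset.sum_mul, ← Finset.sum_sub_distrib]
  refine Finset.sum_congr rfl fun i _ => ?_
  rw [map_mul, algHom_C, proj, aeval_X, map_mul, algebraMap_eq]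
  ring

/-- The substitution changes each variable by a multiple of `lin n`. When `n ⬝ᵥ v = 1` it also kills
`lin n`, so it realises reduction modulo that line inside `T`, where unique factorization is
available. -/
theorem lin_dvd_sub_proj (v n : Fin 3 → ℂ) (p : T) : lin n ∣ p - proj v n p := by
  rw [← Ideal.mem_span_singleton, ← Ideal.Quotient.eq]
  have : Ideal.Quotient.mkₐ ℂ (Ideal.span {lin n}) =
      (Ideal.Quotient.mkₐ ℂ (Ideal.span {lin n})).comp (proj v n) := by
    refine MvPolynomial.algHom_ext fun i => ?_
    rw [AlgHom.comp_apply, proj, aeval_X]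
    refine Ideal.Quotient.eq.mpr (Ideal.mem_span_singleton.mpr ⟨C (v i), by ring⟩)
  exact DFunLike.congr_fun this p

/-- Simultaneous interpolation on lines not through the point `v`. -/
theorem exists_interpolation {κ σ : Type*} {v : Fin 3 → ℂ} (G : (Fin 3 → ℂ) →ₗ[ℂ] T)
    {R : Finset σ} {c : σ → Fin 3 → ℂ} (hc : ∀ j ∈ R, c j ≠ 0)
    (hcc : ∀ j ∈ R, ∀ j' ∈ R, j ≠ j' → ¬ lin (c j) ∣ lin (c j'))
    (hG : ∀ j ∈ R, lin (c j) ∣ G (c j)) {n : κ → Fin 3 → ℂ} (S : Finset κ)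
    (hn : ∀ i ∈ S, n i ⬝ᵥ v = 1)
    (hmod : ∀ i ∈ S, ∀ i' ∈ S, i ≠ i' → ∃ j ∈ R, ∃ t : ℂ, t ≠ 0 ∧ n i - n i' = t • c j) :
    ∃ g : T, ∀ i ∈ S, lin (n i) ∣ g - G (n i) := by
  classical
  induction S using Finset.induction_on with
  | empty => exact ⟨0, by simp⟩
  | insert a S ha ih =>
    obtain ⟨g, hg⟩ := ih (fun i hi => hn i (Finset.mem_insert_of_mem hi))
      fun i hi i' hi' => hmod i (Finset.mem_insert_of_mem hi) i' (Finset.mem_insert_of_mem hi')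
    have hna := hn a (Finset.mem_insert_self _ _)
    have hne : ∀ i ∈ S, i ≠ a := fun i hi h => ha (h ▸ hi)
    -- The later `choose!` needs a default index. Without any index, `hmod` leaves no line other
    -- than `a`.
    rcases isEmpty_or_nonempty σ with hσ | hσ
    · refine ⟨G (n a), fun i hi => ?_⟩
      rcases Finset.mem_insert.mp hi with rfl | hi
      · simp
      · obtain ⟨j, -⟩ := hmod i (Finset.mem_insert_of_mem hi) a (Finset.mem_insert_self _ _)
          (hne i hi)
        exact (hσ.false j).elim
    have hmod' : ∀ i ∈ S, ∃ j : σ, ∃ t : ℂ, j ∈ R ∧ t ≠ 0 ∧ n i - n a = t • c j := by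
      intro i hi
      obtain ⟨j, hj, t, ht, e⟩ := hmod i (Finset.mem_insert_of_mem hi) a
        (Finset.mem_insert_self _ _) (hne i hi)
      exact ⟨j, t, hj, ht, e⟩
    choose! j t hjR ht hjt using hmod'
    have hn0 : ∀ i ∈ S, n i ≠ 0 := by
      rintro i hi h0
      simpa [h0] using hn i (Finset.mem_insert_of_mem hi)
    have hproj : ∀ i ∈ S, proj v (n a) (lin (n i)) = C (t i) * lin (c (j i)) := by
      intro i hi
      rw [proj_lin, hn i (Finset.mem_insert_of_mem hi), C_1, one_mul, ← map_sub, hjt i hi,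
        map_smul, smul_eq_C_mul]
    have hproj_a : proj v (n a) (lin (n a)) = 0 := by
      rw [proj_lin, hna, C_1, one_mul, sub_self]
    have hndvd : ∀ i ∈ S, ∀ i' ∈ S, i ≠ i' → ¬ lin (n i) ∣ lin (n i') := by
      intro i hi i' hi' hii' hd
      obtain ⟨b, -, hb⟩ := exists_smul_of_lin_dvd_lin (hn0 i' hi') hd
      have h1 : b = 1 := by
        have := hn i' (Finset.mem_insert_of_mem hi')
        rwa [hb, smul_dotProduct, hn i (Finset.mem_insert_of_mem hi), smul_eq_mul, mul_one] at this
      obtain ⟨k, hk, s, hs, e⟩ := hmod i (Finset.mem_insert_of_mem hi) i'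
        (Finset.mem_insert_of_mem hi') hii'
      rw [hb, h1, one_smul, sub_self] at e
      exact (smul_ne_zero hs (hc k hk)) e.symm
    -- All lines of one fibre reduce modulo `n a` to multiples of the same `c k`, so coprimality
    -- after reduction is lost. Instead divisibility by the coprime `n i` is proved before
    -- reduction, for a polynomial with the same image. With `G (c k) = lin (c k) * w`, linearity
    -- gives `G (n i) - G (n a) = (lin (n i) - lin (n a)) * w`, which makes the shift by `lin (n a)
    -- * w` work for the whole fibre at once.
    have hfib : ∀ k ∈ R, ∏ i ∈ S with j i = k, lin (c k) ∣ proj v (n a) (g - G (n a)) := by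
      intro k hk
      obtain ⟨w, hw⟩ := hG k hk
      have h1 : ∏ i ∈ S with j i = k, lin (n i) ∣ g - G (n a) + lin (n a) * w := by
        refine Finset.prod_dvd_of_isRelPrime ?_ ?_
        · intro i hi i' hi' hii'
          have hi := (Finset.mem_filter.mp (Finset.mem_coe.mp hi)).1
          have hi' := (Finset.mem_filter.mp (Finset.mem_coe.mp hi')).1
          exact isRelPrime_lin (hn0 i hi) (hndvd i hi i' hi' hii')
        · intro i hi
          obtain ⟨hiS, rfl⟩ := Finset.mem_filter.mp hi
          have e1 : lin (n i) - lin (n a) = C (t i) * lin (c (j i)) := by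
            rw [← map_sub, hjt i hiS, map_smul, smul_eq_C_mul]
          have e2 : G (n i) - G (n a) = C (t i) * (lin (c (j i)) * w) := by
            rw [← map_sub, hjt i hiS, map_smul, smul_eq_C_mul, hw]
          have e3 : g - G (n a) + lin (n a) * w = (g - G (n i)) + lin (n i) * w := by
            linear_combination e2 - w * e1
          rw [e3]
          exact dvd_add (hg i hiS) (dvd_mul_right _ _)
      have h2 := map_dvd (proj v (n a)) h1
      rw [map_add _ (g - G (n a)), map_mul, hproj_a, zero_mul, add_zero, map_prod] at h2
      refine dvd_trans (Finset.prod_dvd_prod_of_dvd _ _ fun i hi => ?_) h2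
      obtain ⟨hiS, rfl⟩ := Finset.mem_filter.mp hi
      rw [hproj i hiS]
      exact dvd_mul_left _ _
    have hall : ∏ i ∈ S, proj v (n a) (lin (n i)) ∣ proj v (n a) (g - G (n a)) := by
      have h1 : ∏ k ∈ R, ∏ i ∈ S with j i = k, lin (c k) ∣ proj v (n a) (g - G (n a)) := by
        refine Finset.prod_dvd_of_isRelPrime ?_ hfib
        intro k hk k' hk' hkk'
        exact IsRelPrime.prod_left fun i _ => IsRelPrime.prod_right fun i' _ =>
          isRelPrime_lin (hc k hk) (hcc k hk k' hk' hkk')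
      have h2 : ∏ k ∈ R, ∏ i ∈ S with j i = k, lin (c k) = ∏ i ∈ S, lin (c (j i)) := by
        rw [← Finset.prod_fiberwise_of_maps_to hjR]
        refine Finset.prod_congr rfl fun k _ => Finset.prod_congr rfl fun i hi => ?_
        rw [(Finset.mem_filter.mp hi).2]
      rw [h2] at h1
      rw [Finset.prod_congr rfl hproj, Finset.prod_mul_distrib]
      have hu : IsUnit (∏ i ∈ S, (C (t i) : T)) := by
        rw [← map_prod]
        exact (isUnit_iff_ne_zero.mpr (Finset.prod_ne_zero_iff.mpr ht)).map C
      exact (hu.mul_left_dvd).mpr h1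
    obtain ⟨r, hr⟩ := hall
    -- The correction vanishes on the lines already treated, and `r` is the quotient making it equal
    -- to `g - G (n a)` on the new line.
    refine ⟨g - (∏ i ∈ S, lin (n i)) * r, fun i hi => ?_⟩
    rcases Finset.mem_insert.mp hi with rfl | hi
    · have h1 := lin_dvd_sub_proj v (n i) (g - G (n i))
      have h2 := lin_dvd_sub_proj v (n i) (∏ i ∈ S, lin (n i))
      rw [hr] at h1
      rw [map_prod] at h2
      have h3 := dvd_sub h1 (h2.mul_right r)
      convert h3 using 1
      ring
    · have h1 := (Finset.dvd_prod_of_mem (fun i => lin (n i)) hi).mul_right r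
      have h2 := dvd_sub (hg i hi) h1
      convert h2 using 1
      ring

/-! ### Syzygies of three polynomials -/

/-- The partial derivatives of a polynomial. -/
def partials (f : T) (i : Fin 3) : T := pderiv i f

theorem cross_mul_eq_cross_mul {R : Type*} [CommRing R] {F U V : Fin 3 → R}
    (hU : ∑ i, U i * F i = 0) (hV : ∑ i, V i * F i = 0) (i j : Fin 3) :
    (crossProduct U V) i * F j = (crossProduct U V) j * F i := by
  rw [Fin.sum_univ_three] at hU hV
  fin_cases i <;> fin_cases j <;> simp [cross_apply]
  · linear_combination V 2 * hU - U 2 * hV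
  · linear_combination U 1 * hV - V 1 * hU
  · linear_combination U 2 * hV - V 2 * hU
  · linear_combination V 0 * hU - U 0 * hV
  · linear_combination V 1 * hU - U 1 * hV
  · linear_combination U 0 * hV - V 0 * hU

theorem cross_mul_eq_zero {R : Type*} [CommRing R] {D U V : Fin 3 → R}
    (hU : crossProduct D U = 0) (hV : crossProduct D V = 0) (k l : Fin 3) :
    (crossProduct U V) k * D l = 0 := by
  have u0 := congrFun hU 0
  have u1 := congrFun hU 1
  have u2 := congrFun hU 2
  have v0 := congrFun hV 0
  have v1 := congrFun hV 1
  have v2 := congrFun hV 2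
  simp [cross_apply] at u0 u1 u2 v0 v1 v2
  fin_cases k <;> fin_cases l <;> simp [cross_apply]
  · linear_combination U 0 * v0 + V 1 * u1 + V 2 * u2
  · linear_combination U 1 * v0 - V 1 * u0
  · linear_combination U 2 * v0 - V 2 * u0
  · linear_combination U 0 * v1 - V 0 * u1
  · linear_combination U 1 * v1 + V 0 * u0 + V 2 * u2
  · linear_combination U 2 * v1 - V 2 * u1
  · linear_combination U 0 * v2 - V 0 * u2
  · linear_combination U 1 * v2 - V 1 * u2
  · linear_combination U 2 * v2 + V 0 * u0 + V 1 * u1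

/-- Three polynomials without common divisor, in the form in which it is used. -/
def IsPrimitive (F : Fin 3 → T) : Prop :=
  F ≠ 0 ∧ ∀ q s : T, (∀ i, q ∣ F i * s) → q ∣ s

/-- Induction on the prime factors of `q`: each prime misses some `F i`, hence divides `s` and can
be cancelled. -/
theorem isPrimitive_of_prime {F : Fin 3 → T} (h : ∀ p : T, Prime p → ∃ i, ¬ p ∣ F i) :
    IsPrimitive F := by
  have hF : F ≠ 0 := by
    rintro rfl
    obtain ⟨i, hi⟩ := h _ (prime_lin (c := 1) one_ne_zero)
    exact hi (dvd_zero _)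
  refine ⟨hF, fun q => ?_⟩
  refine UniqueFactorizationMonoid.induction_on_prime q ?_ ?_ ?_
  · intro s hs
    obtain ⟨i, hi⟩ := Function.ne_iff.mp hF
    exact zero_dvd_iff.mpr ((mul_eq_zero.mp (zero_dvd_iff.mp (hs i))).resolve_left hi)
  · exact fun x hx s _ => hx.dvd
  · intro a p _ hp ih s hs
    obtain ⟨i, hi⟩ := h p hp
    obtain ⟨r, rfl⟩ := (hp.dvd_or_dvd ((dvd_mul_right p a).trans (hs i))).resolve_left hi
    refine mul_dvd_mul_left p (ih r fun i => ?_)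
    have := hs i
    rw [mul_left_comm] at this
    exact (mul_dvd_mul_iff_left hp.ne_zero).mp this

/-- Both `U` and `V` are orthogonal to `F`, so their cross product is parallel to `F` over the
fraction field; primitivity clears the denominator. -/
theorem IsPrimitive.exists_cross_eq {F U V : Fin 3 → T} (hF : IsPrimitive F)
    (hU : ∑ i, U i * F i = 0) (hV : ∑ i, V i * F i = 0) :
    ∃ A : T, crossProduct U V = A • F := by
  obtain ⟨j, hj⟩ := Function.ne_iff.mp hF.1
  have h := cross_mul_eq_cross_mul hU hV
  obtain ⟨A, hA⟩ : F j ∣ (crossProduct U V) j := hF.2 _ _ fun i =>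
    ⟨(crossProduct U V) i, by rw [mul_comm, ← h i j, mul_comm]⟩
  refine ⟨A, funext fun i => mul_left_cancel₀ hj ?_⟩
  rw [Pi.smul_apply, smul_eq_mul, mul_comm, h i j, hA]
  ring

/-- `θ₁` and `θ₂` are syzygies of `F` whose exterior product is a nonzero multiple of `F`. -/
structure IsSyzygyBasis (F θ₁ θ₂ : Fin 3 → T) : Prop where
  left : ∑ i, θ₁ i * F i = 0
  right : ∑ i, θ₂ i * F i = 0
  cross : ∃ c : ℂ, c ≠ 0 ∧ crossProduct θ₁ θ₂ = (C c : T) • F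

/-- Cramer's rule: `W × θ₂` and `W × θ₁` are multiples of `F`, and dividing by the constant `c`
yields the coefficients. The remainder is parallel to both `θ₁` and `θ₂`, whose cross product is
nonzero, so it vanishes. -/
theorem IsSyzygyBasis.exists_eq {F θ₁ θ₂ W : Fin 3 → T} (hF : IsPrimitive F)
    (h : IsSyzygyBasis F θ₁ θ₂) (hW : ∑ i, W i * F i = 0) :
    ∃ A B : T, W = A • θ₁ + B • θ₂ := by
  obtain ⟨c, hc, e⟩ := h.cross
  obtain ⟨A, hA⟩ := hF.exists_cross_eq hW h.right
  obtain ⟨B, hB⟩ := hF.exists_cross_eq hW h.left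
  have hcc : C c⁻¹ * C c = (1 : T) := by rw [← C_mul, inv_mul_cancel₀ hc, C_1]
  refine ⟨C c⁻¹ * A, - (C c⁻¹ * B), sub_eq_zero.mp ?_⟩
  set D := W - ((C c⁻¹ * A) • θ₁ + (-(C c⁻¹ * B)) • θ₂) with hD
  have h1 : crossProduct D θ₁ = 0 := by
    simp only [hD, map_sub, map_add, map_smul, LinearMap.sub_apply, LinearMap.add_apply,
      LinearMap.smul_apply, hB, cross_self, smul_zero, zero_add]
    rw [← cross_anticomm, e, smul_neg, neg_smul, neg_neg, smul_smul, mul_assoc, mul_comm B,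
      ← mul_assoc, hcc, one_mul, sub_self]
  have h2 : crossProduct D θ₂ = 0 := by
    simp only [hD, map_sub, map_add, map_smul, LinearMap.sub_apply, LinearMap.add_apply,
      LinearMap.smul_apply, hA, cross_self, smul_zero, add_zero]
    rw [e, smul_smul, mul_assoc, mul_comm A, ← mul_assoc, hcc, one_mul, sub_self]
  obtain ⟨j, hj⟩ := Function.ne_iff.mp hF.1
  funext l
  have h3 := cross_mul_eq_zero h1 h2 j l
  rw [e] at h3
  exact (mul_eq_zero.mp h3).resolve_left (mul_ne_zero (C_ne_zero.mpr hc) hj)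

theorem IsSyzygyBasis.exists_isHomogeneous_eq {F θ₁ θ₂ W : Fin 3 → T} (hF : IsPrimitive F)
    (h : IsSyzygyBasis F θ₁ θ₂) (hW : ∑ i, W i * F i = 0) {a b e : ℕ}
    (h₁ : ∀ i, (θ₁ i).IsHomogeneous a) (h₂ : ∀ i, (θ₂ i).IsHomogeneous b)
    (hWe : ∀ i, (W i).IsHomogeneous e) (hae : a ≤ e) (hbe : b ≤ e) :
    ∃ A B : T, A.IsHomogeneous (e - a) ∧ B.IsHomogeneous (e - b) ∧
      ∀ i, W i = A * θ₁ i + B * θ₂ i := by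
  obtain ⟨A, B, hAB⟩ := h.exists_eq hF hW
  refine ⟨homogeneousComponent (e - a) A, homogeneousComponent (e - b) B,
    homogeneousComponent_isHomogeneous _ _, homogeneousComponent_isHomogeneous _ _, fun i => ?_⟩
  have h3 : W i = θ₁ i * A + θ₂ i * B := by
    rw [hAB]
    simp only [Pi.add_apply, Pi.smul_apply, smul_eq_mul]
    ring
  rw [← homogeneousComponent_eq_self (hWe i), h3, map_add,
    homogeneousComponent_mul_of_le (h₁ i) hae, homogeneousComponent_mul_of_le (h₂ i) hbe]
  ring

/-! ### Sections of the structure sheaf and of its twists -/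

theorem OSec.ext_germs {U : Opens P2} {s t : OSec U}
    (h : ∀ x : U, (s.1 x).val = (t.1 x).val) : s = t :=
  Subtype.ext (funext fun x => HomogeneousLocalization.val_injective _ (h x))

theorem algebraMap_loc_injective (x : ProjectiveSpectrum grading) :
    Function.Injective (algebraMap T (Loc x)) :=
  IsLocalization.injective _ x.asHomogeneousIdeal.toIdeal.primeCompl_le_nonZeroDivisors

theorem algebraMap_loc_ne_zero {x : ProjectiveSpectrum grading} {q : T}
    (h : q ∉ x.asHomogeneousIdeal) : algebraMap T (Loc x) q ≠ 0 := by
  rw [← map_zero (algebraMap T (Loc x))]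
  refine (algebraMap_loc_injective x).ne ?_
  rintro rfl
  exact h (zero_mem _)

instance (x : ProjectiveSpectrum grading) : IsDomain (Loc x) :=
  IsLocalization.isDomain_localization x.asHomogeneousIdeal.toIdeal.primeCompl_le_nonZeroDivisors

/-- The degree zero part of `Loc x`. -/
abbrev HLoc (x : ProjectiveSpectrum grading) : Type :=
  HomogeneousLocalization.AtPrime grading x.asHomogeneousIdeal.toIdeal

theorem HLoc.val_mk_eq {x : ProjectiveSpectrum grading} {i : ℕ} (p q : grading i)
    (hq : q.1 ∉ x.asHomogeneousIdeal) {t : Loc x}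
    (h : t * algebraMap T (Loc x) q.1 = algebraMap T (Loc x) p.1) :
    (HomogeneousLocalization.mk ⟨i, p, q, hq⟩ : HLoc x).val = t := by
  rw [HomogeneousLocalization.val_mk, Localization.mk_eq_mk', IsLocalization.mk'_eq_iff_eq_mul]
  exact h.symm

theorem sum_algebraMap_mul_eq_zero {F θ : Fin 3 → T} (h : ∑ i, θ i * F i = 0)
    (x : ProjectiveSpectrum grading) :
    ∑ i, algebraMap T (Loc x) (θ i) * algebraMap T (Loc x) (F i) = 0 := by
  simpa only [map_sum, map_mul, map_zero] using congrArg (algebraMap T (Loc x)) h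

theorem exists_mul_algebraMap_eq {x : ProjectiveSpectrum grading} {q : T}
    (hq : q ∉ x.asHomogeneousIdeal) (p : T) :
    ∃ t : Loc x, t * algebraMap T (Loc x) q = algebraMap T (Loc x) p :=
  ⟨_, IsLocalization.mk'_spec (Loc x) p
    (⟨q, hq⟩ : x.asHomogeneousIdeal.toIdeal.primeCompl)⟩

theorem mul_map_cross_eq_zero {R : Type*} [CommRing R] (f : T →+* R) {U V : Fin 3 → T} {s t : R}
    (h : ∀ i, s * f (U i) + t * f (V i) = 0) (j : Fin 3) :
    s * f ((crossProduct U V) j) = 0 ∧ t * f ((crossProduct U V) j) = 0 := by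
  have h0 := h 0
  have h1 := h 1
  have h2 := h 2
  fin_cases j <;>
    simp only [cross_apply, Fin.zero_eta, Fin.mk_one, Fin.reduceFinMk, Matrix.cons_val, map_sub,
      map_mul] <;> constructor
  · linear_combination f (V 2) * h1 - f (V 1) * h2
  · linear_combination f (U 1) * h2 - f (U 2) * h1
  · linear_combination f (V 0) * h2 - f (V 2) * h0
  · linear_combination f (U 2) * h0 - f (U 0) * h2
  · linear_combination f (V 1) * h0 - f (V 0) * h1
  · linear_combination f (U 0) * h1 - f (U 1) * h0

theorem exists_val_eq {U : Opens P2} {t : Germs U} (ht : IsLocallyFractionOfDegree 0 t) (x : U) :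
    ∃ z : HLoc x.1, z.val = t x := by
  obtain ⟨V, hV, hxV, j, i, p, q, e, hp, hq, H⟩ := ht x.1 x.2
  obtain ⟨h1, h2⟩ := H x.1 hxV
  obtain rfl : j = i := by omega
  exact ⟨HomogeneousLocalization.mk ⟨j, ⟨p, hp⟩, ⟨q, hq⟩, h1⟩, HLoc.val_mk_eq _ _ h1 h2⟩

/-- A section of `𝒪(0)`, viewed as a section of the structure sheaf. -/
def OSec.ofGerms {U : Opens P2} (t : Germs U) (ht : IsLocallyFractionOfDegree 0 t) : OSec U :=
  ⟨fun x => (exists_val_eq ht x).choose, fun x => by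
    obtain ⟨V, hV, hxV, j, i, p, q, e, hp, hq, H⟩ := ht x.1 x.2
    obtain rfl : j = i := by omega
    refine ⟨V, hxV, homOfLE hV, j, ⟨p, hp⟩, ⟨q, hq⟩, fun y => (H y.1 y.2).1, fun y => ?_⟩
    refine HomogeneousLocalization.val_injective _ ?_
    exact ((exists_val_eq ht ⟨y.1, hV y.2⟩).choose_spec).trans
      (HLoc.val_mk_eq ⟨p, hp⟩ ⟨q, hq⟩ (H y.1 y.2).1 (H y.1 y.2).2).symm⟩

theorem OSec.ofGerms_val {U : Opens P2} (t : Germs U) (ht : IsLocallyFractionOfDegree 0 t)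
    (x : U) : ((OSec.ofGerms t ht).1 x).val = t x :=
  (exists_val_eq ht x).choose_spec

theorem OSec.exists_fraction {U : Opens P2} (s : OSec U) (x : P2) (hx : x ∈ U) :
    ∃ (V : Opens P2) (hVU : V ≤ U), x ∈ V ∧ ∃ (i : ℕ) (p q : T), p.IsHomogeneous i ∧
      q.IsHomogeneous i ∧ ∀ (y : P2) (hy : y ∈ V), q ∉ y.asHomogeneousIdeal ∧
        (s.1 ⟨y, hVU hy⟩).val * algebraMap T (Loc y) q = algebraMap T (Loc y) p := by
  obtain ⟨V, hxV, ι, k, r, r', hr', hs⟩ := s.2 ⟨x, hx⟩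
  refine ⟨V, ι.le, hxV, k, r.1, r'.1, r.2, r'.2, fun y hy => ⟨hr' ⟨y, hy⟩, ?_⟩⟩
  have h3 : s.1 ⟨y, ι.le hy⟩ = HomogeneousLocalization.mk ⟨k, r, r', hr' ⟨y, hy⟩⟩ := hs ⟨y, hy⟩
  rw [h3, HomogeneousLocalization.val_mk, Localization.mk_eq_mk']
  exact IsLocalization.mk'_spec _ _ _

theorem IsLocallyFractionOfDegree.mul_poly {U : Opens P2} {t : Germs U} {n : ℕ} {g : T}
    (ht : IsLocallyFractionOfDegree (-n) t) (hg : g.IsHomogeneous n) :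
    IsLocallyFractionOfDegree 0 fun x => t x * algebraMap T (Loc x.1) g := by
  intro x hx
  obtain ⟨V, hV, hxV, j, i, p, q, e, hp, hq, H⟩ := ht x hx
  refine ⟨V, hV, hxV, j + n, i, p * g, q, by push_cast; omega, hp.mul hg, hq, fun y hy => ?_⟩
  refine ⟨(H y hy).1, ?_⟩
  rw [map_mul, ← (H y hy).2]
  ring

/-- Near every point there is a nowhere vanishing homogeneous polynomial of large degree. -/
theorem exists_isHomogeneous_notMem (N : ℕ) (U : Opens P2) (x : P2) (hx : x ∈ U) :
    ∃ (V : Opens P2) (_ : V ≤ U), x ∈ V ∧ ∃ (e : ℕ) (q : T), N ≤ e ∧ q.IsHomogeneous e ∧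
      ∀ y ∈ V, q ∉ y.asHomogeneousIdeal := by
  -- Any denominator representing the zero section of degree `-N` has degree `i = j + N ≥ N`.
  obtain ⟨V, hV, hxV, j, i, p, q, e, hp, hq, H⟩ :=
    IsLocallyFractionOfDegree.zero (-(N : ℤ)) U x hx
  exact ⟨V, hV, hxV, i, q, by omega, hq, fun y hy => (H y hy).1⟩

theorem exists_common_fraction {U : Opens P2} (w : Fin 3 → OSec U) (N : ℕ) (x : P2)
    (hx : x ∈ U) :
    ∃ (V : Opens P2) (hVU : V ≤ U), x ∈ V ∧ ∃ (e : ℕ) (p : Fin 3 → T) (q : T), N ≤ e ∧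
      (∀ i, (p i).IsHomogeneous e) ∧ q.IsHomogeneous e ∧
      ∀ (y : P2) (hy : y ∈ V), q ∉ y.asHomogeneousIdeal ∧ ∀ i,
        ((w i).1 ⟨y, hVU hy⟩).val * algebraMap T (Loc y) q = algebraMap T (Loc y) (p i) := by
  obtain ⟨V, hV, hxV, e, q, he, hq, H⟩ := exists_isHomogeneous_notMem N U x hx
  obtain ⟨V₀, hV₀, hxV₀, e₀, p₀, q₀, hp₀, hq₀, H₀⟩ := (w 0).exists_fraction x hx
  obtain ⟨V₁, hV₁, hxV₁, e₁, p₁, q₁, hp₁, hq₁, H₁⟩ := (w 1).exists_fraction x hx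
  obtain ⟨V₂, hV₂, hxV₂, e₂, p₂, q₂, hp₂, hq₂, H₂⟩ := (w 2).exists_fraction x hx
  refine ⟨V ⊓ V₀ ⊓ V₁ ⊓ V₂, inf_le_right.trans hV₂, ⟨⟨⟨hxV, hxV₀⟩, hxV₁⟩, hxV₂⟩,
    e + e₀ + e₁ + e₂, ![q * p₀ * q₁ * q₂, q * q₀ * p₁ * q₂, q * q₀ * q₁ * p₂],
    q * q₀ * q₁ * q₂, by omega, ?_, ((hq.mul hq₀).mul hq₁).mul hq₂, ?_⟩
  · intro i
    fin_cases i
    · exact ((hq.mul hp₀).mul hq₁).mul hq₂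
    · exact ((hq.mul hq₀).mul hp₁).mul hq₂
    · exact ((hq.mul hq₀).mul hq₁).mul hp₂
  · rintro y ⟨⟨⟨hy, hy₀⟩, hy₁⟩, hy₂⟩
    refine ⟨fun h => ?_, fun i => ?_⟩
    · rcases y.isPrime.mem_or_mem h with h | h
      · rcases y.isPrime.mem_or_mem h with h | h
        · rcases y.isPrime.mem_or_mem h with h | h
          · exact H y hy h
          · exact (H₀ y hy₀).1 h
        · exact (H₁ y hy₁).1 h
      · exact (H₂ y hy₂).1 h
    · fin_cases i
      · simp only [map_mul, Matrix.cons_val_zero, Fin.zero_eta, ← (H₀ y hy₀).2]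
        ring
      · simp only [map_mul, Matrix.cons_val_one, Fin.mk_one, Matrix.cons_val_zero,
          ← (H₁ y hy₁).2]
        ring
      · simp only [map_mul, Matrix.cons_val, Fin.reduceFinMk, ← (H₂ y hy₂).2]
        ring

namespace LineArrangement

variable (A : LineArrangement)

theorem mem_derivationBundle {U : Opens P2} {w : Fin 3 → OSec U} :
    w ∈ A.derivationBundle U ↔
      ∀ x : U, ∑ i, ((w i).1 x).val * algebraMap T (Loc x.1) (partials A.poly i) = 0 := by
  have key : ∀ x : U, (A.gradient U w).1 x =
      ∑ i, ((w i).1 x).val * algebraMap T (Loc x.1) (partials A.poly i) := by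
    intro x
    simp only [gradient, Fin.sum_univ_three]
    rfl
  rw [derivationBundle, LinearMap.mem_ker, Subtype.ext_iff, funext_iff]
  exact forall_congr' fun x => by rw [key]; rfl

/-! ### The splitting of the derivation bundle given by a homogeneous syzygy basis. -/

section Splitting

variable {A} {a b : ℕ} {θ₁ θ₂ : Fin 3 → T} (h₁ : ∀ i, (θ₁ i).IsHomogeneous a)
  (h₂ : ∀ i, (θ₂ i).IsHomogeneous b) (h : IsSyzygyBasis (partials A.poly) θ₁ θ₂)

/-- The section `s θ₁ᵢ + t θ₂ᵢ` of the structure sheaf. -/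
def pairing {U : Opens P2} (s : twist (-(a : ℤ)) U) (t : twist (-(b : ℤ)) U) (i : Fin 3) :
    OSec U :=
  OSec.ofGerms (fun x => s.1 x * algebraMap T (Loc x.1) (θ₁ i))
      (IsLocallyFractionOfDegree.mul_poly s.2 (h₁ i)) +
    OSec.ofGerms (fun x => t.1 x * algebraMap T (Loc x.1) (θ₂ i))
      (IsLocallyFractionOfDegree.mul_poly t.2 (h₂ i))

theorem pairing_val {U : Opens P2} (s : twist (-(a : ℤ)) U) (t : twist (-(b : ℤ)) U) (i : Fin 3)
    (x : U) : ((pairing h₁ h₂ s t i).1 x).val =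
      s.1 x * algebraMap T (Loc x.1) (θ₁ i) + t.1 x * algebraMap T (Loc x.1) (θ₂ i) := by
  refine (HomogeneousLocalization.val_add _ _).trans ?_
  rw [OSec.ofGerms_val, OSec.ofGerms_val]

include h in
theorem pairing_mem {U : Opens P2} (s : twist (-(a : ℤ)) U) (t : twist (-(b : ℤ)) U) :
    pairing h₁ h₂ s t ∈ A.derivationBundle U := by
  rw [mem_derivationBundle]
  intro x
  have e1 := sum_algebraMap_mul_eq_zero h.left x.1
  have e2 := sum_algebraMap_mul_eq_zero h.right x.1
  simp only [Fin.sum_univ_three] at e1 e2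
  simp only [pairing_val, Fin.sum_univ_three]
  linear_combination s.1 x * e1 + t.1 x * e2

/-- The map `𝒪(-a) ⊕ 𝒪(-b) → 𝒟_A` given by two homogeneous syzygies. -/
def toDerivationBundle (U : Opens P2) :
    (twist (-(a : ℤ)) U × twist (-(b : ℤ)) U) →ₗ[OSec U] A.derivationBundle U where
  toFun s := ⟨pairing h₁ h₂ s.1 s.2, pairing_mem h₁ h₂ h s.1 s.2⟩
  map_add' s t := by
    refine Subtype.ext (funext fun i => OSec.ext_germs fun x => ?_)
    refine (pairing_val h₁ h₂ _ _ i x).trans ?_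
    refine Eq.trans ?_ (HomogeneousLocalization.val_add _ _).symm
    rw [pairing_val, pairing_val]
    change (s.1.1 x + t.1.1 x) * _ + (s.2.1 x + t.2.1 x) * _ = _
    ring
  map_smul' r s := by
    refine Subtype.ext (funext fun i => OSec.ext_germs fun x => ?_)
    refine (pairing_val h₁ h₂ _ _ i x).trans ?_
    refine Eq.trans ?_ (HomogeneousLocalization.val_mul _ _).symm
    rw [pairing_val, RingHom.id_apply]
    change ((r.1 x).val * s.1.1 x) * _ + ((r.1 x).val * s.2.1 x) * _ = _
    ring

/-- Crossing the relation with one syzygy isolates the other coefficient times `θ₁ × θ₂`, which has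
a nonzero component in the domain `Loc x`. This uniqueness is also what glues local coefficients. -/
theorem _root_.LineArr.IsSyzygyBasis.coeff_eq_zero {F : Fin 3 → T} (hF : IsPrimitive F)
    (h : IsSyzygyBasis F θ₁ θ₂) (x : ProjectiveSpectrum grading) {s t : Loc x}
    (e : ∀ i, s * algebraMap T (Loc x) (θ₁ i) + t * algebraMap T (Loc x) (θ₂ i) = 0) :
    s = 0 ∧ t = 0 := by
  obtain ⟨c, hc, hcr⟩ := h.cross
  obtain ⟨j, hj⟩ := Function.ne_iff.mp hF.1
  have hne : algebraMap T (Loc x) ((crossProduct θ₁ θ₂) j) ≠ 0 := by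
    rw [← map_zero (algebraMap T (Loc x)), hcr]
    exact (algebraMap_loc_injective x).ne (mul_ne_zero (C_ne_zero.mpr hc) hj)
  obtain ⟨h1, h2⟩ := mul_map_cross_eq_zero (algebraMap T (Loc x)) e j
  exact ⟨(mul_eq_zero.mp h1).resolve_right hne, (mul_eq_zero.mp h2).resolve_right hne⟩

include h in
theorem toDerivationBundle_injective (hF : IsPrimitive (partials A.poly)) (U : Opens P2) :
    Function.Injective (toDerivationBundle h₁ h₂ h U) := by
  rintro ⟨s, t⟩ ⟨s', t'⟩ hst
  have key : ∀ x : U, s.1 x = s'.1 x ∧ t.1 x = t'.1 x := by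
    intro x
    have h3 := h.coeff_eq_zero hF x.1 (s := s.1 x - s'.1 x) (t := t.1 x - t'.1 x) fun i => by
      have h4 : pairing h₁ h₂ s t i = pairing h₁ h₂ s' t' i :=
        congrFun (congrArg Subtype.val hst) i
      have h5 := pairing_val h₁ h₂ s t i x
      rw [h4, pairing_val] at h5
      linear_combination -h5
    exact ⟨sub_eq_zero.mp h3.1, sub_eq_zero.mp h3.2⟩
  exact Prod.ext (Subtype.ext (funext fun x => (key x).1))
    (Subtype.ext (funext fun x => (key x).2))

-- Over a common denominator the numerators form a polynomial syzygy, checked in one local ring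
-- since `T` embeds there. The degree is taken at least `a + b`, so that `e - a` and `e - b` are
-- genuine differences.
include h₁ h₂ h in
theorem exists_local_coeff (hF : IsPrimitive (partials A.poly)) {U : Opens P2} {w : Fin 3 → OSec U}
    (hw : w ∈ A.derivationBundle U) (x : P2) (hx : x ∈ U) :
    ∃ (V : Opens P2) (hVU : V ≤ U), x ∈ V ∧ ∃ (e : ℕ) (p₁ p₂ q : T), a ≤ e ∧ b ≤ e ∧
      p₁.IsHomogeneous (e - a) ∧ p₂.IsHomogeneous (e - b) ∧ q.IsHomogeneous e ∧
      ∀ (y : P2) (hy : y ∈ V), q ∉ y.asHomogeneousIdeal ∧ ∀ i,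
        ((w i).1 ⟨y, hVU hy⟩).val * algebraMap T (Loc y) q =
          algebraMap T (Loc y) p₁ * algebraMap T (Loc y) (θ₁ i) +
            algebraMap T (Loc y) p₂ * algebraMap T (Loc y) (θ₂ i) := by
  obtain ⟨V, hV, hxV, e, p, q, he, hp, hq, H⟩ := exists_common_fraction w (a + b) x hx
  have h0 : ∑ i, p i * partials A.poly i = 0 := by
    refine algebraMap_loc_injective x ?_
    have h1 := (A.mem_derivationBundle.mp hw) ⟨x, hx⟩
    have h2 := (H x hxV).2
    rw [map_sum, map_zero]
    simp only [map_mul, ← h2]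
    simp only [Fin.sum_univ_three] at h1 ⊢
    linear_combination algebraMap T (Loc x) q * h1
  obtain ⟨p₁, p₂, hp₁, hp₂, hpe⟩ :=
    h.exists_isHomogeneous_eq hF h0 h₁ h₂ hp (by omega) (by omega)
  refine ⟨V, hV, hxV, e, p₁, p₂, q, by omega, by omega, hp₁, hp₂, hq, fun y hy =>
    ⟨(H y hy).1, fun i => ?_⟩⟩
  rw [(H y hy).2 i, hpe i, map_add, map_mul, map_mul]

include h in
theorem toDerivationBundle_surjective (hF : IsPrimitive (partials A.poly)) (U : Opens P2) :
    Function.Surjective (toDerivationBundle h₁ h₂ h U) := by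
  rintro ⟨w, hw⟩
  have hloc := exists_local_coeff h₁ h₂ h hF hw
  have hex : ∀ x : U, ∃ s t : Loc x.1, ∀ i, ((w i).1 x).val =
      s * algebraMap T (Loc x.1) (θ₁ i) + t * algebraMap T (Loc x.1) (θ₂ i) := by
    rintro ⟨x, hx⟩
    obtain ⟨V, hV, hxV, e, p₁, p₂, q, -, -, -, -, -, H⟩ := hloc x hx
    obtain ⟨hq, H⟩ := H x hxV
    obtain ⟨s, hs⟩ := exists_mul_algebraMap_eq hq p₁
    obtain ⟨t, ht⟩ := exists_mul_algebraMap_eq hq p₂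
    refine ⟨s, t, fun i => mul_right_cancel₀ (algebraMap_loc_ne_zero hq) ?_⟩
    rw [H i, ← hs, ← ht]
    ring
  choose s t hst using hex
  -- The germs `s` and `t` were chosen pointwise; uniqueness of coefficients forces them to agree
  -- with the local fractions.
  have key : ∀ x ∈ U, ∃ (V : Opens P2) (hVU : V ≤ U), x ∈ V ∧ ∃ (e : ℕ) (p₁ p₂ q : T),
      a ≤ e ∧ b ≤ e ∧ p₁.IsHomogeneous (e - a) ∧ p₂.IsHomogeneous (e - b) ∧ q.IsHomogeneous e ∧
      ∀ (y : P2) (hy : y ∈ V), q ∉ y.asHomogeneousIdeal ∧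
        s ⟨y, hVU hy⟩ * algebraMap T (Loc y) q = algebraMap T (Loc y) p₁ ∧
        t ⟨y, hVU hy⟩ * algebraMap T (Loc y) q = algebraMap T (Loc y) p₂ := by
    intro x hx
    obtain ⟨V, hV, hxV, e, p₁, p₂, q, hae, hbe, hp₁, hp₂, hq, H⟩ := hloc x hx
    refine ⟨V, hV, hxV, e, p₁, p₂, q, hae, hbe, hp₁, hp₂, hq, fun y hy => ⟨(H y hy).1, ?_⟩⟩
    have h3 := h.coeff_eq_zero hF y
      (s := s ⟨y, hV hy⟩ * algebraMap T (Loc y) q - algebraMap T (Loc y) p₁)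
      (t := t ⟨y, hV hy⟩ * algebraMap T (Loc y) q - algebraMap T (Loc y) p₂) fun i => by
        linear_combination (H y hy).2 i - algebraMap T (Loc y) q * hst ⟨y, hV hy⟩ i
    exact ⟨sub_eq_zero.mp h3.1, sub_eq_zero.mp h3.2⟩
  refine ⟨(⟨s, fun x hx => ?_⟩, ⟨t, fun x hx => ?_⟩), ?_⟩
  · obtain ⟨V, hV, hxV, e, p₁, p₂, q, hae, hbe, hp₁, hp₂, hq, H⟩ := key x hx
    exact ⟨V, hV, hxV, e - a, e, p₁, q, by omega, hp₁, hq, fun y hy => ⟨(H y hy).1, (H y hy).2.1⟩⟩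
  · obtain ⟨V, hV, hxV, e, p₁, p₂, q, hae, hbe, hp₁, hp₂, hq, H⟩ := key x hx
    exact ⟨V, hV, hxV, e - b, e, p₂, q, by omega, hp₂, hq, fun y hy => ⟨(H y hy).1, (H y hy).2.2⟩⟩
  · refine Subtype.ext (funext fun i => OSec.ext_germs fun x => ?_)
    exact (pairing_val h₁ h₂ _ _ i x).trans (hst x i).symm

include h₁ h₂ h in
theorem isFreeWithSplittingType_of_isSyzygyBasis (hF : IsPrimitive (partials A.poly)) :
    A.IsFreeWithSplittingType a b := by
  refine ⟨⟨fun U => LinearEquiv.ofBijective (toDerivationBundle h₁ h₂ h U)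
    ⟨toDerivationBundle_injective h₁ h₂ h hF U, toDerivationBundle_surjective h₁ h₂ h hF U⟩, ?_⟩⟩
  intro U V hVU s t i
  refine OSec.ext_germs fun x => ?_
  refine (pairing_val h₁ h₂ _ _ i x).trans ?_
  exact (pairing_val h₁ h₂ s t i ⟨x.1, hVU x.2⟩).symm

end Splitting

end LineArrangement

/-! ### Syzygies of the gradient from logarithmic vector fields -/

theorem deriv_eq_sum_partials (w : Fin 3 → T) (f : T) : deriv w f = ∑ i, w i * partials f i :=
  deriv_apply w f

theorem sum_X_mul_partials {f : T} {d : ℕ} (hf : f.IsHomogeneous d) :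
    ∑ i, X i * partials f i = C (d : ℂ) * f := by
  have h := hf.sum_X_mul_pderiv
  rw [nsmul_eq_mul] at h
  simpa [partials] using h

theorem deriv_isHomogeneous {w : Fin 3 → T} {p : T} {a k e : ℕ}
    (hw : ∀ i, (w i).IsHomogeneous a) (hp : p.IsHomogeneous k) (he : a + k = e + 1) :
    (deriv w p).IsHomogeneous e := by
  rw [deriv_apply]
  refine IsHomogeneous.sum _ _ _ fun i _ => ?_
  rcases Nat.eq_zero_or_pos k with rfl | hk
  · rw [totalDegree_eq_zero_iff_eq_C.mp (Nat.le_zero.mp hp.totalDegree_le), pderiv_C,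
      mul_zero]
    exact isHomogeneous_zero _ _ _
  · obtain rfl : e = a + (k - 1) := by omega
    exact (hw i).mul hp.pderiv

/-- Subtracting Euler multiples makes both fields kill `f` without changing their determinant with
the Euler field. Their cross product `Z` is then parallel to `∇f`, and Euler's formula gives `d f
Z_j = (∑ X_i Z_i) ∂_j f = c f ∂_j f`; cancelling `f` leaves the constant `c / d`. -/
theorem isSyzygyBasis_of_logarithmic {f : T} (hf0 : f ≠ 0) {d : ℕ} (hd : d ≠ 0)
    (hf : f.IsHomogeneous d) {η₁ η₂ : Fin 3 → T} {h₁ h₂ : T} (e₁ : deriv η₁ f = f * h₁)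
    (e₂ : deriv η₂ f = f * h₂) {c : ℂ} (hc : c ≠ 0)
    (hdet : ∑ i, X i * (crossProduct η₁ η₂) i = C c * f) :
    IsSyzygyBasis (partials f) (fun i => η₁ i - C (d : ℂ)⁻¹ * h₁ * X i)
      (fun i => η₂ i - C (d : ℂ)⁻¹ * h₂ * X i) := by
  have hE := sum_X_mul_partials hf
  have hdC : (C (d : ℂ)⁻¹ * C (d : ℂ) : T) = 1 := by
    rw [← C_mul, inv_mul_cancel₀ (Nat.cast_ne_zero.mpr hd), C_1]
  have hsyz : ∀ {η : Fin 3 → T} {h : T}, deriv η f = f * h →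
      ∑ i, (η i - C (d : ℂ)⁻¹ * h * X i) * partials f i = 0 := by
    intro η h e
    rw [deriv_eq_sum_partials] at e
    simp only [Fin.sum_univ_three] at e hE ⊢
    linear_combination e - C (d : ℂ)⁻¹ * h * hE - f * h * hdC
  refine ⟨hsyz e₁, hsyz e₂, (d : ℂ)⁻¹ * c,
    mul_ne_zero (inv_ne_zero (Nat.cast_ne_zero.mpr hd)) hc, funext fun j => ?_⟩
  have hx := fun i => cross_mul_eq_cross_mul (hsyz e₁) (hsyz e₂) i j
  set Z := crossProduct (fun i => η₁ i - C (d : ℂ)⁻¹ * h₁ * X i)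
    (fun i => η₂ i - C (d : ℂ)⁻¹ * h₂ * X i) with hZ
  have hdet' : ∑ i, X i * Z i = C c * f := by
    rw [← hdet, hZ]
    simp only [Fin.sum_univ_three, cross_apply, Matrix.cons_val]
    ring
  refine mul_left_cancel₀ hf0 ?_
  rw [Pi.smul_apply, smul_eq_mul, C_mul]
  simp only [Fin.sum_univ_three] at hE hdet'
  have h0 := hx 0
  have h1 := hx 1
  have h2 := hx 2
  linear_combination C (d : ℂ)⁻¹ * partials f j * hdet' - f * Z j * hdC
    - C (d : ℂ)⁻¹ * Z j * hE - C (d : ℂ)⁻¹ * (X 0 * h0 + X 1 * h1 + X 2 * h2)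

/-- The constant vector field `v`. -/
def constField (v : Fin 3 → ℂ) (i : Fin 3) : T := C (v i)

theorem deriv_constField_lin (v c : Fin 3 → ℂ) : deriv (constField v) (lin c) = C (c ⬝ᵥ v) := by
  rw [deriv_lin, dotProduct, map_sum]
  exact Finset.sum_congr rfl fun i _ => by rw [constField, ← C_mul, mul_comm]

/-- The vector field `∇f × u`. -/
def hamiltonian (f : T) (u : Fin 3 → ℂ) : Fin 3 → T := crossProduct (partials f) (constField u)

theorem deriv_hamiltonian_self (f : T) (u : Fin 3 → ℂ) : deriv (hamiltonian f u) f = 0 := by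
  rw [deriv_eq_sum_partials]
  simp only [hamiltonian, Fin.sum_univ_three, cross_apply, Matrix.cons_val]
  ring

/-- For `f = lin c * r`, the gradient is `r c` modulo `lin c`, and `(c × u) · c = 0`. -/
theorem lin_dvd_deriv_hamiltonian {f : T} {c : Fin 3 → ℂ} (h : lin c ∣ f) (u : Fin 3 → ℂ) :
    lin c ∣ deriv (hamiltonian f u) (lin c) := by
  obtain ⟨r, rfl⟩ := h
  have hg : ∀ i, partials (lin c * r) i = lin c * partials r i + r * C (c i) := by
    intro i
    rw [partials, Derivation.leibniz, pderiv_lin, smul_eq_mul, smul_eq_mul, partials]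
  refine ⟨deriv (hamiltonian r u) (lin c), ?_⟩
  simp only [deriv_lin, hamiltonian, Fin.sum_univ_three, cross_apply, Matrix.cons_val, hg]
  ring

theorem hamiltonian_isHomogeneous {f : T} {m : ℕ} (hf : f.IsHomogeneous m) (u : Fin 3 → ℂ)
    (i : Fin 3) : (hamiltonian f u i).IsHomogeneous (m - 1) := by
  have h : ∀ i j, (partials f i * constField u j).IsHomogeneous (m - 1) := fun i j =>
    (hf.pderiv (i := i)).mul (isHomogeneous_C _ _)
  rw [hamiltonian, cross_apply]
  fin_cases i
  · exact (h _ _).sub (h _ _)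
  · exact (h _ _).sub (h _ _)
  · exact (h _ _).sub (h _ _)

/-- The determinant of the Euler field, `∇f × u + g v` and `q v`. -/
theorem sum_X_mul_cross_hamiltonian {f : T} {m : ℕ} (hf : f.IsHomogeneous m)
    {u v : Fin 3 → ℂ} (huv : u ⬝ᵥ v = 1) (hv : deriv (constField v) f = 0) (g q : T) :
    ∑ i, X i * (crossProduct (hamiltonian f u + g • constField v) (q • constField v)) i =
      C (-(m : ℂ)) * (f * q) := by
  have hE := sum_X_mul_partials hf
  rw [deriv_eq_sum_partials] at hv
  have huv' : ∑ i, constField u i * constField v i = 1 := by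
    simp only [constField, ← C_mul]
    rw [← map_sum, ← C_1, ← huv, dotProduct]
  rw [C_neg]
  simp only [Fin.sum_univ_three] at hE hv huv' ⊢
  simp only [hamiltonian, cross_apply, Matrix.cons_val, Pi.add_apply, Pi.smul_apply, smul_eq_mul]
  -- The `g` term drops out as `v × v = 0`, and `(∇f × u) × v = (∇f · v) u - (u · v) ∇f = -∇f`;
  -- Euler's formula finishes.
  linear_combination -q * hE - q * (X 0 * partials f 0 + X 1 * partials f 1 + X 2 * partials f 2) *
    huv' + q * (X 0 * constField u 0 + X 1 * constField u 1 + X 2 * constField u 2) * hv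

/-! ### Incidence of points and lines -/

theorem orthogonal_iff (L P : ℙ ℂ (Fin 3 → ℂ)) :
    Projectivization.orthogonal L P ↔ L.rep ⬝ᵥ P.rep = 0 := by
  conv_lhs => rw [← L.mk_rep, ← P.mk_rep]
  exact Projectivization.orthogonal_mk _ _

theorem eq_of_rep_eq_smul {L L' : ℙ ℂ (Fin 3 → ℂ)} {a : ℂ} (h : L'.rep = a • L.rep) :
    L' = L := by
  rw [← L.mk_rep, ← L'.mk_rep, Projectivization.mk_eq_mk_iff']
  exact ⟨a, h.symm⟩

theorem eq_of_lin_dvd_lin {L L' : ℙ ℂ (Fin 3 → ℂ)} (h : lin L.rep ∣ lin L'.rep) : L' = L := by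
  obtain ⟨a, -, ha⟩ := exists_smul_of_lin_dvd_lin L'.rep_nonzero h
  exact eq_of_rep_eq_smul ha

theorem cross_cross_eq_zero {v c d : Fin 3 → ℂ} (hc : c ⬝ᵥ v = 0) (hd : d ⬝ᵥ v = 0) :
    crossProduct v (crossProduct c d) = 0 := by
  rw [dotProduct, Fin.sum_univ_three] at hc hd
  funext i
  fin_cases i <;> simp only [cross_apply, Fin.zero_eta, Fin.mk_one, Fin.reduceFinMk,
    Matrix.cons_val, Pi.zero_apply]
  · linear_combination c 0 * hd - d 0 * hc
  · linear_combination c 1 * hd - d 1 * hc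
  · linear_combination c 2 * hd - d 2 * hc

/-- Two lines through two distinct points are equal. -/
theorem cross_eq_zero_of_dotProduct_eq_zero {P Q : ℙ ℂ (Fin 3 → ℂ)} (hPQ : P ≠ Q)
    {c d : Fin 3 → ℂ} (hcP : c ⬝ᵥ P.rep = 0) (hcQ : c ⬝ᵥ Q.rep = 0) (hdP : d ⬝ᵥ P.rep = 0)
    (hdQ : d ⬝ᵥ Q.rep = 0) : crossProduct c d = 0 := by
  by_contra hz
  apply hPQ
  -- If `c × d` were nonzero, both points would be the single intersection point it represents.
  have h1 := (Projectivization.mk_eq_mk_iff_crossProduct_eq_zero P.rep_nonzero hz).mpr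
    (cross_cross_eq_zero hcP hdP)
  have h2 := (Projectivization.mk_eq_mk_iff_crossProduct_eq_zero Q.rep_nonzero hz).mpr
    (cross_cross_eq_zero hcQ hdQ)
  rw [Projectivization.mk_rep] at h1 h2
  rw [h1, h2]

theorem exists_smul_of_cross_eq_zero {c d : Fin 3 → ℂ} (hc : c ≠ 0) (hd : d ≠ 0)
    (h : crossProduct c d = 0) : ∃ t : ℂ, t ≠ 0 ∧ d = t • c := by
  obtain ⟨t, ht⟩ := (Projectivization.mk_eq_mk_iff' ℂ d c hd hc).mp
    ((Projectivization.mk_eq_mk_iff_crossProduct_eq_zero hc hd).mpr h).symm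
  refine ⟨t, ?_, ht.symm⟩
  rintro rfl
  exact hd (by rw [← ht, zero_smul])

theorem eq_of_orthogonal {P Q L L' : ℙ ℂ (Fin 3 → ℂ)} (hPQ : P ≠ Q)
    (hP : L.orthogonal P) (hQ : L.orthogonal Q) (hP' : L'.orthogonal P)
    (hQ' : L'.orthogonal Q) : L = L' := by
  rw [orthogonal_iff] at hP hQ hP' hQ'
  obtain ⟨t, -, ht⟩ := exists_smul_of_cross_eq_zero L'.rep_nonzero L.rep_nonzero
    (cross_eq_zero_of_dotProduct_eq_zero hPQ hP' hQ' hP hQ)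
  exact eq_of_rep_eq_smul ht

theorem exists_orthogonal {L L' : ℙ ℂ (Fin 3 → ℂ)} (h : L ≠ L') :
    ∃ Q, L.orthogonal Q ∧ L'.orthogonal Q := by
  classical
  exact ⟨_, Projectivization.orthogonal_cross_left h, Projectivization.orthogonal_cross_right h⟩

namespace LineArrangement

open Classical in
/-- The lines of `A` through `P`. -/
def through (A : LineArrangement) (P : ℙ ℂ (Fin 3 → ℂ)) : Finset (ℙ ℂ (Fin 3 → ℂ)) :=
  A.filter fun L => L.orthogonal P

open Classical in
/-- The lines of `A` not through `P`. -/
def away (A : LineArrangement) (P : ℙ ℂ (Fin 3 → ℂ)) : Finset (ℙ ℂ (Fin 3 → ℂ)) :=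
  A.filter fun L => ¬ L.orthogonal P

variable {A : LineArrangement} {P : ℙ ℂ (Fin 3 → ℂ)}

open Classical in
theorem mem_through {L : ℙ ℂ (Fin 3 → ℂ)} : L ∈ A.through P ↔ L ∈ A ∧ L.orthogonal P :=
  Finset.mem_filter

open Classical in
theorem mem_away {L : ℙ ℂ (Fin 3 → ℂ)} : L ∈ A.away P ↔ L ∈ A ∧ ¬ L.orthogonal P :=
  Finset.mem_filter

theorem mult_eq_card_through : A.mult P = (A.through P).card := by
  rw [mult, ← Set.ncard_coe_finset]
  congr 1
  ext L
  exact mem_through.symm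

open Classical in
theorem card_through_add_card_away : (A.through P).card + (A.away P).card = A.card :=
  Finset.card_filter_add_card_filter_not _

theorem poly_eq_prod_lin : A.poly = ∏ L ∈ A, lin L.rep :=
  Finset.prod_congr rfl fun L _ => (lin_apply L.rep).symm

open Classical in
theorem poly_eq_mul :
    A.poly = (∏ L ∈ A.through P, lin L.rep) * ∏ L ∈ A.away P, lin L.rep := by
  rw [poly_eq_prod_lin]
  exact (Finset.prod_filter_mul_prod_filter_not _ _ _).symm

theorem poly_ne_zero : A.poly ≠ 0 := by
  rw [poly_eq_prod_lin]
  exact Finset.prod_ne_zero_iff.mpr fun L _ => lin_ne_zero L.rep_nonzero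

theorem prod_lin_isHomogeneous (S : Finset (ℙ ℂ (Fin 3 → ℂ))) :
    (∏ L ∈ S, lin L.rep).IsHomogeneous S.card := by
  simpa using IsHomogeneous.prod S (fun L => lin L.rep) (fun _ => 1)
    fun L _ => lin_isHomogeneous L.rep

theorem mem_sing_of_mem {L L' Q : ℙ ℂ (Fin 3 → ℂ)} (hL : L ∈ A) (hL' : L' ∈ A) (h : L ≠ L')
    (hQ : L.orthogonal Q) (hQ' : L'.orthogonal Q) : Q ∈ A.Sing := by
  change 2 ≤ A.mult Q
  rw [mult_eq_card_through]
  exact Finset.one_lt_card.mpr ⟨L, mem_through.mpr ⟨hL, hQ⟩, L', mem_through.mpr ⟨hL', hQ'⟩, h⟩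

/-- By Euler's formula a common prime factor of the partials divides `f`, so it is one of the lines
up to a unit. That line would then divide the product of the others, against distinctness. -/
theorem isPrimitive_partials (hA : A.Nonempty) : IsPrimitive (partials A.poly) := by
  classical
  refine isPrimitive_of_prime fun p hp => ?_
  by_contra! hcon
  have h1 : p ∣ C (A.card : ℂ) * A.poly := by
    rw [← sum_X_mul_partials A.poly_isHomogeneous]
    exact Finset.dvd_sum fun i _ => (hcon i).mul_left _
  have hu : IsUnit (C (A.card : ℂ) : T) :=
    (isUnit_iff_ne_zero.mpr (Nat.cast_ne_zero.mpr hA.card_pos.ne')).map C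
  have h2 : p ∣ A.poly := (hu.dvd_mul_left).mp h1
  rw [poly_eq_prod_lin, hp.dvd_finsetProd_iff] at h2
  obtain ⟨L, hL, hpL⟩ := h2
  have hLp : lin L.rep ∣ p := hp.irreducible.dvd_symm (irreducible_lin L.rep_nonzero) hpL
  obtain ⟨i, hi⟩ := Function.ne_iff.mp L.rep_nonzero
  have h3 := hLp.trans (hcon i)
  rw [partials, poly_eq_prod_lin, ← Finset.mul_prod_erase A _ hL, Derivation.leibniz,
    pderiv_lin, smul_eq_mul, smul_eq_mul, dvd_add_right (dvd_mul_right _ _)] at h3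
  have hiu : IsUnit (C (L.rep i) : T) := (isUnit_iff_ne_zero.mpr hi).map C
  have h4 := (hiu.dvd_mul_right).mp h3
  rw [(prime_lin L.rep_nonzero).dvd_finsetProd_iff] at h4
  obtain ⟨L', hL', hd⟩ := h4
  exact Finset.ne_of_mem_erase hL' (eq_of_lin_dvd_lin hd)

/-! ### Modular points -/

/-- The coefficient vector of a line, normalised to have value one at `P`. -/
def normalized (P L : ℙ ℂ (Fin 3 → ℂ)) : Fin 3 → ℂ := (L.rep ⬝ᵥ P.rep)⁻¹ • L.rep

theorem normalized_dotProduct {L : ℙ ℂ (Fin 3 → ℂ)} (h : ¬ L.orthogonal P) :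
    normalized P L ⬝ᵥ P.rep = 1 := by
  rw [orthogonal_iff] at h
  rw [normalized, smul_dotProduct, smul_eq_mul, inv_mul_cancel₀ h]

theorem lin_rep_eq {L : ℙ ℂ (Fin 3 → ℂ)} (h : ¬ L.orthogonal P) :
    lin L.rep = C (L.rep ⬝ᵥ P.rep) * lin (normalized P L) := by
  rw [orthogonal_iff] at h
  rw [← smul_eq_C_mul, ← map_smul, normalized, smul_smul, mul_inv_cancel₀ h, one_smul]

/-- The difference is nonzero and vanishes at `P`, by the normalisation, and at `L ∩ L'`. It is
therefore an equation of the line joining them, which modularity puts in `A`. -/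
theorem IsModular.exists_normalized_sub_eq (hP : A.IsModular P) {L L' : ℙ ℂ (Fin 3 → ℂ)}
    (hL : L ∈ A.away P) (hL' : L' ∈ A.away P) (h : L ≠ L') :
    ∃ M ∈ A.through P, ∃ t : ℂ, t ≠ 0 ∧ normalized P L - normalized P L' = t • M.rep := by
  rw [mem_away] at hL hL'
  obtain ⟨Q, hQ, hQ'⟩ := exists_orthogonal h
  have hQP : P ≠ Q := by
    rintro rfl
    exact hL.2 hQ
  obtain ⟨M, hM, hMP, hMQ⟩ := hP Q (mem_sing_of_mem hL.1 hL'.1 h hQ hQ') hQP.symm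
  refine ⟨M, mem_through.mpr ⟨hM, hMP⟩, ?_⟩
  have hδ : normalized P L - normalized P L' ≠ 0 := by
    intro h0
    have h1 := (orthogonal_iff L P).not.mp hL.2
    have h2 : L.rep = (L.rep ⬝ᵥ P.rep) • normalized P L := by
      rw [normalized, smul_smul, mul_inv_cancel₀ h1, one_smul]
    rw [sub_eq_zero.mp h0, normalized, smul_smul] at h2
    exact h (eq_of_rep_eq_smul h2)
  rw [orthogonal_iff] at hQ hQ' hMP hMQ
  refine exists_smul_of_cross_eq_zero M.rep_nonzero hδ
    (cross_eq_zero_of_dotProduct_eq_zero hQP hMP hMQ ?_ ?_)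
  · rw [sub_dotProduct, normalized_dotProduct hL.2, normalized_dotProduct hL'.2, sub_self]
  · rw [sub_dotProduct, normalized, normalized, smul_dotProduct, smul_dotProduct, hQ, hQ',
      smul_zero, smul_zero, sub_zero]

theorem exists_dotProduct_eq_one {v : Fin 3 → ℂ} (hv : v ≠ 0) : ∃ u : Fin 3 → ℂ, u ⬝ᵥ v = 1 := by
  obtain ⟨i, hi⟩ := Function.ne_iff.mp hv
  exact ⟨Pi.single i (v i)⁻¹, by rw [single_dotProduct, inv_mul_cancel₀ hi]⟩

theorem IsModular.exists_field (hP : A.IsModular P) (u : Fin 3 → ℂ) :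
    ∃ g : T, g.IsHomogeneous ((A.through P).card - 1) ∧ ∀ L ∈ A.away P,
      lin L.rep ∣ deriv (hamiltonian (∏ L ∈ A.through P, lin L.rep) u +
        g • constField P.rep) (lin L.rep) := by
  set f := ∏ L ∈ A.through P, lin L.rep with hf
  set m := (A.through P).card
  -- On a normalised form `∂_v` takes the value one, so tangency means that `g` is congruent to `G`
  -- of that form modulo it.
  obtain ⟨G, hG⟩ : ∃ G : (Fin 3 → ℂ) →ₗ[ℂ] T, ∀ c, G c = -deriv (hamiltonian f u) (lin c) :=
    ⟨-((deriv (hamiltonian f u)).toLinearMap ∘ₗ lin), fun _ => rfl⟩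
  have hGM : ∀ M ∈ A.through P, lin M.rep ∣ G M.rep := by
    intro M hM
    rw [hG, dvd_neg]
    exact lin_dvd_deriv_hamiltonian
      (Finset.dvd_prod_of_mem (fun L : ℙ ℂ (Fin 3 → ℂ) => lin L.rep) hM) u
  obtain ⟨g₀, hg₀⟩ := exists_interpolation (v := P.rep) G (R := A.through P)
    (c := fun M => M.rep) (n := normalized P) (fun M _ => M.rep_nonzero)
    (fun M _ M' _ hMM' hd => hMM' (eq_of_lin_dvd_lin hd).symm) hGM
    (A.away P) (fun L hL => normalized_dotProduct (mem_away.mp hL).2)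
    (fun L hL L' hL' h => hP.exists_normalized_sub_eq hL hL' h)
  -- The prescribed values are homogeneous of degree `m - 1`, so that component of `g₀` satisfies
  -- the same congruences.
  refine ⟨homogeneousComponent (m - 1) g₀, homogeneousComponent_isHomogeneous _ _, ?_⟩
  intro L hL
  have hGL : (G (normalized P L)).IsHomogeneous (m - 1) := by
    rw [hG]
    exact (deriv_isHomogeneous (hamiltonian_isHomogeneous (prod_lin_isHomogeneous _) u)
      (lin_isHomogeneous _) rfl).neg
  have h1 := dvd_homogeneousComponent (lin_isHomogeneous _) (m - 1) (hg₀ L hL)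
  rw [map_sub, homogeneousComponent_eq_self hGL, hG, sub_neg_eq_add] at h1
  have h2 : deriv (hamiltonian f u + homogeneousComponent (m - 1) g₀ • constField P.rep)
      (lin (normalized P L)) = homogeneousComponent (m - 1) g₀ +
        deriv (hamiltonian f u) (lin (normalized P L)) := by
    have h3 := deriv_constField_lin P.rep (normalized P L)
    rw [normalized_dotProduct (mem_away.mp hL).2, C_1] at h3
    simp only [deriv_apply, Fin.sum_univ_three, Pi.add_apply, Pi.smul_apply, smul_eq_mul] at h3 ⊢
    linear_combination homogeneousComponent (m - 1) g₀ * h3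
  rw [lin_rep_eq (mem_away.mp hL).2, ← smul_eq_C_mul, Derivation.map_smul, h2, smul_eq_C_mul,
    smul_eq_C_mul]
  exact mul_dvd_mul_left _ h1

theorem IsModular.isFreeWithSplittingType (hP : A.IsModular P) (h2 : 2 ≤ A.mult P) :
    A.IsFreeWithSplittingType ((A.mult P : ℤ) - 1) ((A.card : ℤ) - (A.mult P : ℤ)) := by
  obtain ⟨u, hu⟩ := exists_dotProduct_eq_one P.rep_nonzero
  obtain ⟨g, hg, hgL⟩ := hP.exists_field u
  have hcard := card_through_add_card_away (A := A) (P := P)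
  have hf := poly_eq_mul (A := A) (P := P)
  have hf₁ := prod_lin_isHomogeneous (A.through P)
  have hf₂ := prod_lin_isHomogeneous (A.away P)
  rw [mult_eq_card_through] at h2 ⊢
  set f₁ := ∏ L ∈ A.through P, lin L.rep
  set f₂ := ∏ L ∈ A.away P, lin L.rep
  set m := (A.through P).card
  set k := (A.away P).card
  set η := hamiltonian f₁ u + g • constField P.rep with hη
  have hv₁ : deriv (constField P.rep) f₁ = 0 := by
    refine deriv_prod_eq_zero _ _ _ fun L hL => ?_
    rw [deriv_constField_lin, (orthogonal_iff _ _).mp (mem_through.mp hL).2, C_0]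
  have hη₁ : deriv η f₁ = 0 := by
    have h := deriv_hamiltonian_self f₁ u
    simp only [hη, deriv_apply, Fin.sum_univ_three, Pi.add_apply, Pi.smul_apply,
      smul_eq_mul] at h hv₁ ⊢
    linear_combination h + g * hv₁
  have hηhom : ∀ i, (η i).IsHomogeneous (m - 1) := fun i =>
    (hamiltonian_isHomogeneous hf₁ u i).add (by
      simpa [constField] using hg.mul (isHomogeneous_C (Fin 3) (P.rep i)))
  obtain ⟨h, hh, hηf⟩ := exists_isHomogeneous_mul_eq hf₂
    (deriv_isHomogeneous hηhom hf₂ (e := m + k - 2) (by omega))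
    (prod_dvd_deriv_prod η _ _ hgL)
  have e₁ : deriv η A.poly = A.poly * h := by
    rw [hf, Derivation.leibniz, hη₁, hηf, smul_zero, add_zero, smul_eq_mul, mul_assoc]
  have e₂ : deriv (f₂ • constField P.rep) A.poly = A.poly * deriv (constField P.rep) f₂ := by
    have h' : deriv (f₂ • constField P.rep) A.poly = f₂ * deriv (constField P.rep) A.poly := by
      simp only [deriv_apply, Fin.sum_univ_three, Pi.smul_apply, smul_eq_mul]
      ring
    rw [h', hf, Derivation.leibniz, hv₁, smul_zero, add_zero, smul_eq_mul]
    ring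
  have hdet := sum_X_mul_cross_hamiltonian hf₁ hu hv₁ g f₂
  rw [← hf] at hdet
  have hbasis := isSyzygyBasis_of_logarithmic poly_ne_zero (by omega) A.poly_isHomogeneous e₁ e₂
    (neg_ne_zero.mpr (Nat.cast_ne_zero.mpr (by omega))) hdet
  have hfree := isFreeWithSplittingType_of_isSyzygyBasis (A := A) (a := m - 1) (b := k) ?_ ?_
    hbasis (isPrimitive_partials (Finset.card_pos.mp (by omega)))
  · convert hfree using 1 <;> omega
  · intro i
    refine (hηhom i).sub ?_
    have h3 := (hh.C_mul (A.card : ℂ)⁻¹).mul (isHomogeneous_X ℂ i)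
    rwa [show m + k - 2 - k + 1 = m - 1 by omega] at h3
  · intro i
    refine IsHomogeneous.sub (by simpa [constField] using hf₂.mul (isHomogeneous_C (Fin 3) (P.rep i))) ?_
    -- When every line passes through `P`, `f₂ = 1` and its derivative vanishes; the degree `k - 1`
    -- makes sense only otherwise.
    rcases Nat.eq_zero_or_pos k with hk | hk
    · have h3 : deriv (constField P.rep) f₂ = 0 := by
        have : f₂ = 1 := Finset.prod_eq_one fun L hL => by
          rw [Finset.card_eq_zero.mp hk] at hL
          exact absurd hL (Finset.notMem_empty L)
        rw [this, Derivation.map_one_eq_zero]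
      rw [h3, mul_zero, zero_mul]
      exact isHomogeneous_zero _ _ _
    · have h3 := ((deriv_isHomogeneous (a := 0) (e := k - 1)
        (fun i => isHomogeneous_C (Fin 3) (P.rep i)) hf₂ (by omega)).C_mul
          (A.card : ℂ)⁻¹).mul (isHomogeneous_X ℂ i)
      rwa [show k - 1 + 1 = k by omega] at h3

/-! ### Modular points of maximal multiplicity. -/

theorem sing_nonempty (hd : 2 ≤ A.card) : A.Sing.Nonempty := by
  obtain ⟨L, hL, L', hL', h⟩ := Finset.one_lt_card.mp hd
  obtain ⟨Q, hQ, hQ'⟩ := exists_orthogonal h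
  exact ⟨Q, mem_sing_of_mem hL hL' h hQ hQ'⟩

theorem bddAbove_mult (A : LineArrangement) : BddAbove (A.mult '' A.Sing) := by
  refine ⟨A.card, ?_⟩
  rintro _ ⟨P, -, rfl⟩
  have := card_through_add_card_away (A := A) (P := P)
  rw [mult_eq_card_through]
  omega

/-- If `L` missed both points, sending a line `M` through `Q` to the line of `A` joining `P` and `L
∩ M` would be injective, so `Q` could not have the larger multiplicity. -/
theorem IsModular.orthogonal_or_of_mult_lt {Q : ℙ ℂ (Fin 3 → ℂ)} (hP : A.IsModular P)
    (h : A.mult P < A.mult Q) {L : ℙ ℂ (Fin 3 → ℂ)} (hL : L ∈ A) :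
    L.orthogonal P ∨ L.orthogonal Q := by
  by_contra! hcon
  rw [mult_eq_card_through, mult_eq_card_through] at h
  have hex : ∀ M ∈ A.through Q, ∃ N ∈ A.through P, ∃ R, L.orthogonal R ∧ M.orthogonal R ∧
      N.orthogonal R := by
    intro M hM
    rw [mem_through] at hM
    have hLM : L ≠ M := by
      rintro rfl
      exact hcon.2 hM.2
    obtain ⟨R, hR, hR'⟩ := exists_orthogonal hLM
    obtain ⟨N, hN, hNP, hNR⟩ := hP R (mem_sing_of_mem hL hM.1 hLM hR hR') (by
      rintro rfl
      exact hcon.1 hR)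
    exact ⟨N, mem_through.mpr ⟨hN, hNP⟩, R, hR, hR', hNR⟩
  choose! N hN R hLR hMR hNR using hex
  obtain ⟨M, hM, M', hM', hMM', e⟩ := Finset.exists_ne_map_eq_of_card_lt_of_maps_to h hN
  have hRR : R M = R M' := by
    by_contra hne
    have h1 : L = N M := eq_of_orthogonal hne (hLR M hM) (hLR M' hM') (hNR M hM)
      (e ▸ hNR M' hM')
    exact hcon.1 (h1 ▸ (mem_through.mp (hN M hM)).2)
  have hRQ : R M ≠ Q := by
    intro h1
    exact hcon.2 (h1 ▸ hLR M hM)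
  exact hMM' (eq_of_orthogonal hRQ (hMR M hM) (mem_through.mp hM).2 (hRR ▸ hMR M' hM')
    (mem_through.mp hM').2)

/-- A point of larger multiplicity than a modular point is modular. -/
theorem IsModular.of_mult_lt {Q : ℙ ℂ (Fin 3 → ℂ)} (hP : A.IsModular P)
    (h : A.mult P < A.mult Q) (hQ : Q ∈ A.Sing) : A.IsModular Q := by
  have hQP : Q ≠ P := by
    rintro rfl
    exact lt_irrefl _ h
  intro R hR hRQ
  by_cases hRP : R = P
  · obtain ⟨L, hL, h1, h2⟩ := hP Q hQ hQP
    exact ⟨L, hL, h2, hRP ▸ h1⟩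
  · by_contra! hcon
    change 2 ≤ A.mult R at hR
    rw [mult_eq_card_through] at hR
    obtain ⟨L, hL, L', hL', hLL'⟩ := Finset.one_lt_card.mp hR
    rw [mem_through] at hL hL'
    -- Every line of `A` meets `{P, Q}`, so if none joins `Q` and `R`, two distinct lines through
    -- `R` would both pass through `P`.
    have key : ∀ M ∈ A, M.orthogonal R → M.orthogonal P := fun M hM hMR =>
      (hP.orthogonal_or_of_mult_lt h hM).resolve_right fun hMQ => hcon M hM hMQ hMR
    exact hLL' (eq_of_orthogonal hRP hL.2 (key L hL.1 hL.2) hL'.2 (key L' hL'.1 hL'.2))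

theorem IsSupersolvable.exists_isModular (hA : A.IsSupersolvable) (hd : 2 ≤ A.card) :
    ∃ P, A.IsModular P ∧ A.mult P = A.maxMult ∧ 2 ≤ A.mult P := by
  obtain ⟨P, hP⟩ := hA
  obtain ⟨Q, hQ, hQm⟩ := Nat.sSup_mem ((sing_nonempty hd).image A.mult) A.bddAbove_mult
  change A.mult Q = A.maxMult at hQm
  -- The given modular point may lie on fewer than two lines; in that case it is replaced by `Q`.
  rcases lt_or_ge (A.mult P) (A.mult Q) with h | h
  · exact ⟨Q, hP.of_mult_lt h hQ, hQm, hQ⟩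
  · have h2 : 2 ≤ A.mult P := le_trans hQ h
    refine ⟨P, hP, le_antisymm ?_ (hQm ▸ h), h2⟩
    exact le_csSup A.bddAbove_mult ⟨P, h2, rfl⟩

end LineArrangement

end LineArr

end

theorem mainTheorem4 (A : LineArr.LineArrangement) (hd : 2 ≤ A.card)
    (hA : A.IsSupersolvable) :
    A.IsFreeWithSplittingType ((A.maxMult : ℤ) - 1) ((A.card : ℤ) - (A.maxMult : ℤ)) := by
  obtain ⟨P, hP, hm, h2⟩ := hA.exists_isModular hd
  rw [← hm]
  exact hP.isFreeWithSplittingType h2
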